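/- Equip \(\mathbb{R}^d\) with the standard inner product. Let \(f\in\mathbb{R}[\theta_1,\dots,\theta_d]\) be homogeneous of degree \(p\) and hyperbolic with respect to a point \(\tau_0\), i.e. \(f(\tau_0)\neq 0\) and for every \(v\in\mathbb{R}^d\) the univariate polynomial \(t\mapsto f(v+t\tau_0)\) has \(p\) real roots, counted with multiplicity; let the sign be normalized by \(f(\tau_0)>0\). Let \(C\) be the hyperbolicity cone, i.e. the connected component of \(\mathbb{R}^d\setminus\{f=0\}\) that contains \(\tau_0\), and assume that \(f\) is complete, i.e. \(\overline{C}\cap(-\overline{C})=\{0\}\). Let \(K=C^\vee=\{\sigma : \langle\theta,\sigma\rangle\ge 0 \text{ for all } \theta\in C\}\), and put \(F=\nabla\log f\) on \(C\). Consider a hyperbolic exponential family of \(f\): the sample space is \(K\), the sufficient statistics are \(T(\sigma)=\sigma\), and \(\nu\) is a (possibly signed) base measure on \(K\) with exponent \(\alpha\), where either \(\alpha>d\) and \(\nu(d\sigma)=q_\alpha(\sigma)\,d\sigma\) with the Riesz kernel \[ q_\alpha(\sigma)=(2\pi)^{-d}\int_{\mathbb{R}^d} f(\theta_0+i\eta)^{-\alpha}\,e^{\langle\theta_0+i\eta,\sigma\rangle}\,d\eta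 \qquad(\theta_0\in C \text{ arbitrary}), \] the power being taken with the branch on \(C+i\mathbb{R}^d\) that is positive on \(C\), or else \(\alpha>0\) is any exponent and \(\nu\) any signed measure (a real weight times a positive measure) on \(K\) such that \(e^{-\langle\theta,\sigma\rangle}\) is \(\nu\)-integrable with \(\int_K e^{-\langle\theta,\sigma\rangle}\,\nu(d\sigma)=f(\theta)^{-\alpha}\) for all \(\theta\in C\). The log-partition function of a family with statistics \(T\) is \(A(\theta)=\log\int e^{-\langle\theta,T\rangle}\,d\nu\), its canonical parameter space is the set of \(\theta\) where this integral converges absolutely, its gradient map is \(-\nabla A\), and its space of sufficient statistics is the convex hull of the image of \(T\). Let \(\mathcal{L}\subset\mathbb{R}^d\) be a linear subspace with \(C\cap\mathcal{L}\neq\emptyset\), let the rows of \(L\in\mathbb{R}^{c\times d}\) be a basis of \(\mathcal{L}\), and restrict the family to \(\mathcal{L}\), i.e. replace \(T\) by \(L\circ T\) and keep \(K\) and \(\nu\). Let \(C_{\mathcal{L}}\subset\mathbb{R}^c\), \(K_{\mathcal{L}}=\mathrm{conv}(L(K))\) and \(F_{\mathcal{L}}\) be the canonical parameter space, the space of sufficient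 statistics and the gradient map of the restricted family. Let \(\mathcal{L}^F_{\succ0}=F(C\cap\mathcal{L})\) be the positive exponential variety. Then: (1) The full family has canonical parameter space \(C\) and space of sufficient statistics \(K\); on \(C\) its partition function is positive, its log-partition function is differentiable, and its gradient map is \(\alpha F\). The maps \(F\) and \(\alpha F\) send \(C\) to \(K\). (2) \(C_{\mathcal{L}}\) is convex and \(\tau\mapsto L^T\tau\) identifies it with \(C\cap\mathcal{L}\). The log-partition function of the restricted family is differentiable on \(C_{\mathcal{L}}\), and \(F_{\mathcal{L}}=L\circ(\alpha F)\circ L^T\) there, i.e. \(F_{\mathcal{L}}\) is the composition \(C_{\mathcal{L}}\cong C\cap\mathcal{L}\subset C\to K\to K_{\mathcal{L}}\) of the inclusion, the gradient map \(\alpha F\) and the projection \(L\). (3) \(F\circ L^T\), and likewise \(\alpha F\circ L^T\), maps \(C_{\mathcal{L}}\) bijectively onto \(\mathcal{L}^F_{\succ0}\), and \(L\) maps \(\mathcal{L}^F_{\succ0}\) bijectively onto the interior of \(K_{\mathcal{L}}\). -/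

import Mathlib

open MeasureTheory Set
open scoped RealInnerProductSpace

noncomputable section

namespace HypExp

/-- The space `ℝⁿ` with its standard inner product. -/
abbrev E (n : ℕ) : Type := EuclideanSpace ℝ (Fin n)

/-! ### Hyperbolic polynomials -/

/-- The polynomial function `ℝᵈ → ℝ` of a real polynomial. -/
def fn {d : ℕ} (f : MvPolynomial (Fin d) ℝ) (θ : E d) : ℝ :=
  MvPolynomial.eval (fun j => θ j) f

/-- The univariate polynomial `t ↦ f (v + t τ)`. -/
def lineRestriction {d : ℕ} (f : MvPolynomial (Fin d) ℝ) (τ v : E d) : Polynomial ℝ :=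
  MvPolynomial.aeval
    (fun j => Polynomial.C (v j) + Polynomial.C (τ j) * (Polynomial.X : Polynomial ℝ)) f

/-- `f` is homogeneous of degree `p`, does not vanish at `τ`, and every (projective) line through
`τ` meets `f = 0` in `p` real points, counted with multiplicity. -/
structure IsHyperbolic {d : ℕ} (f : MvPolynomial (Fin d) ℝ) (p : ℕ) (τ : E d) : Prop where
  homogeneous : f.IsHomogeneous p
  ne_zero : fn f τ ≠ 0
  real_rooted : ∀ v : E d, (lineRestriction f τ v).roots.card = p

/-- The hyperbolicity cone: the connected component of `ℝᵈ \ {f = 0}` that contains `τ`. -/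
def hypCone {d : ℕ} (f : MvPolynomial (Fin d) ℝ) (τ : E d) : Set (E d) :=
  connectedComponentIn {θ | fn f θ ≠ 0} τ

/-- A cone is pointed if its closure contains no line through the origin. -/
def IsPointed {d : ℕ} (C : Set (E d)) : Prop :=
  ∀ x ∈ closure C, -x ∈ closure C → x = 0

/-- The dual cone `{σ | ∀ θ ∈ C, 0 ≤ ⟪θ, σ⟫}`. -/
def dualCone {d : ℕ} (C : Set (E d)) : Set (E d) :=
  (ProperCone.innerDual C : Set (E d))

/-- The map `∇ log f`. -/
def gradLog {d : ℕ} (f : MvPolynomial (Fin d) ℝ) (θ : E d) : E d :=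
  gradient (fun x => Real.log (fn f x)) θ

/-! ### The Riesz kernel -/

/-- The value of `f` at the complex point `θ + i s η`. -/
def fnC {d : ℕ} (f : MvPolynomial (Fin d) ℝ) (θ η : E d) (s : ℝ) : ℂ :=
  MvPolynomial.aeval (fun j => (θ j : ℂ) + Complex.I * (s : ℂ) * (η j : ℂ)) f

/-- The value at `θ + i η` of the branch of `log f` on the tube `C + i ℝᵈ` that is real on `C`:
the continuation of `log f` along the segment from `θ` to `θ + i η`. -/
def logBranch {d : ℕ} (f : MvPolynomial (Fin d) ℝ) (θ η : E d) : ℂ :=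
  (Real.log (fn f θ) : ℂ) +
    ∫ s in (0 : ℝ)..1,
      (∑ j, Complex.I * (η j : ℂ) * fnC (MvPolynomial.pderiv j f) θ η s) / fnC f θ η s

/-- The integrand `f (θ + i η) ^ (-α) * exp ⟪θ + i η, σ⟫`, where the pairing is `ℂ`-bilinear. -/
def rieszIntegrand {d : ℕ} (f : MvPolynomial (Fin d) ℝ) (α : ℝ) (θ σ η : E d) : ℂ :=
  Complex.exp (-(α : ℂ) * logBranch f θ η) *
    Complex.exp ((⟪θ, σ⟫ : ℂ) + Complex.I * (⟪η, σ⟫ : ℂ))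

/-- The Riesz kernel `q_α(σ) = (2π)^(-d) ∫ f (θ + i η) ^ (-α) exp ⟪θ + i η, σ⟫ dη`. The integral is
real, because `η ↦ -η` conjugates the integrand. -/
def rieszKernel {d : ℕ} (f : MvPolynomial (Fin d) ℝ) (α : ℝ) (θ σ : E d) : ℝ :=
  (((2 * Real.pi : ℝ) ^ d)⁻¹ : ℝ) * (∫ η : E d, rieszIntegrand f α θ σ η).re

/-! ### Exponential families with respect to a signed measure -/

/-- An exponential family on the sample space `X` with sufficient statistics `stat` and the
(possibly signed) base measure `ν(dx) = weight(x) base(dx)`. -/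
structure ExpFamily (X : Type) [MeasurableSpace X] (n : ℕ) where
  base : Measure X
  weight : X → ℝ
  stat : X → E n
  measurable_stat : Measurable stat

namespace ExpFamily

variable {X : Type} [MeasurableSpace X] {n m : ℕ}

/-- `exp (-⟪θ, T x⟫)` times the weight of `x`. -/
def integrand (𝓕 : ExpFamily X n) (θ : E n) (x : X) : ℝ :=
  Real.exp (-⟪θ, 𝓕.stat x⟫) * 𝓕.weight x

/-- The space of canonical parameters: where the partition integral is finite. -/
def params (𝓕 : ExpFamily X n) : Set (E n) :=
  {θ | Integrable (𝓕.integrand θ) 𝓕.base}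

/-- The partition function. -/
def partition (𝓕 : ExpFamily X n) (θ : E n) : ℝ :=
  ∫ x, 𝓕.integrand θ x ∂𝓕.base

/-- The log-partition function `A`. -/
def logPartition (𝓕 : ExpFamily X n) (θ : E n) : ℝ :=
  Real.log (𝓕.partition θ)

/-- The gradient map `θ ↦ θ*`, where `DA(θ)(η) = ⟪η, -θ*⟫`. -/
def gradientMap (𝓕 : ExpFamily X n) (θ : E n) : E n :=
  -gradient 𝓕.logPartition θ

/-- The space of sufficient statistics `conv (T(X))`. -/
def statSpace (𝓕 : ExpFamily X n) : Set (E n) :=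
  convexHull ℝ (range 𝓕.stat)

/-- The family with the same sample space and base measure and with sufficient statistics
`L ∘ T`. -/
def restrict (𝓕 : ExpFamily X n) (L : E n →ₗ[ℝ] E m) : ExpFamily X m where
  base := 𝓕.base
  weight := 𝓕.weight
  stat := fun x => L (𝓕.stat x)
  measurable_stat := (LinearMap.continuous_of_finiteDimensional L).measurable.comp
    𝓕.measurable_stat

end ExpFamily

/-- The family with sample space `K ⊆ ℝᵈ`, sufficient statistics `T(σ) = σ` and base measure
`h(σ) μ(dσ)`. -/
def familyOn {d : ℕ} (K : Set (E d)) (μ : Measure K) (h : K → ℝ) : ExpFamily K d where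
  base := μ
  weight := h
  stat := Subtype.val
  measurable_stat := measurable_subtype_coe

/-- `h(σ) μ(dσ)` is a base measure on the dual of the hyperbolicity cone `C` of `f`, for the
exponent `α`: either `α > d`, `μ` is Lebesgue measure and `h` is the Riesz kernel, computed from
some base point `θ₀ ∈ C`; or `α > 0` and the measure represents `f ^ (-α)` on `C` as a Laplace
transform (this covers the smaller exponents for which a representing measure exists). -/
def IsHypBase {d : ℕ} (f : MvPolynomial (Fin d) ℝ) (τ : E d) (α : ℝ)
    (μ : Measure (dualCone (hypCone f τ))) (h : dualCone (hypCone f τ) → ℝ) : Prop :=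
  ((d : ℝ) < α ∧ μ = volume.comap Subtype.val ∧
      ∃ θ₀ ∈ hypCone f τ, ∀ σ, h σ = rieszKernel f α θ₀ σ) ∨
    (0 < α ∧ ∀ θ ∈ hypCone f τ,
      Integrable (fun σ : dualCone (hypCone f τ) => Real.exp (-⟪θ, (σ : E d)⟫) * h σ) μ ∧
      ∫ σ : dualCone (hypCone f τ), Real.exp (-⟪θ, (σ : E d)⟫) * h σ ∂μ = fn f θ ^ (-α))

/-! ### Linear subspaces -/

/-- The matrix whose rows are the elements of a basis of the subspace `ℒ`. -/
def rowMatrix {d c : ℕ} {ℒ : Submodule ℝ (E d)} (b : Module.Basis (Fin c) ℝ ℒ) :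
    Matrix (Fin c) (Fin d) ℝ :=
  Matrix.of fun i j => (b i : E d) j

/-- The projection `L : ℝᵈ → ℝᶜ`. -/
def proj {d c : ℕ} {ℒ : Submodule ℝ (E d)} (b : Module.Basis (Fin c) ℝ ℒ) : E d →ₗ[ℝ] E c :=
  Matrix.toEuclideanLin (rowMatrix b)

/-- The embedding `Lᵀ : ℝᶜ → ℝᵈ`, with image `ℒ`. -/
def embed {d c : ℕ} {ℒ : Submodule ℝ (E d)} (b : Module.Basis (Fin c) ℝ ℒ) : E c →ₗ[ℝ] E d :=
  Matrix.toEuclideanLin (rowMatrix b).transpose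

/-- The positive exponential variety `F(C ∩ ℒ)` with `F = ∇ log f`. -/
def posExpVariety {d : ℕ} (f : MvPolynomial (Fin d) ℝ) (τ : E d) (ℒ : Submodule ℝ (E d)) :
    Set (E d) :=
  gradLog f '' (hypCone f τ ∩ ℒ)

end HypExp

end

noncomputable section

namespace HypExp

open Filter Topology

/-! ### Evaluation at complex points -/

/-! Everything rests on one factorization. By Gårding's theorem (`realRootedAlong_of_mem`) `f` is
real-rooted along every `a ∈ C`, so `C` is a convex cone, and for each direction `b` one has `f (a +
z b) = f a * ∏ (1 - z r_j)` with real `r_j`. Pointedness of `C` makes this quantitative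
(`exists_root_bound`): small `r_j` force a small `b`.

On real lines the factorization shows that `∇ log f` maps `C` into the interior of `K` and is
strictly monotone. On imaginary lines it gives `|f (θ + i η)|² = f θ ² * ∏ (1 + r_j²)`, so `f` has
no zeros on the tube and `|f|^(-α)` decays like `‖η‖^(-α)`, which is integrable for `α > d`.
Cauchy's theorem then makes the Riesz integral independent of the base point; sending the base point
to infinity shows that the kernel vanishes off `K`, and Fourier inversion identifies its Laplace
transform as `f^(-α)`.

Hence for either kind of base measure the log-partition function on `C` is `-α log f`. The parameter
space is exactly `C`: if the integral converged at a point outside, domination along a segment into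
`C` would keep `f^(-α)` bounded where `f` tends to zero.

Restricting the family to `ℒ` composes the log-partition function with `Lᵀ`, whose adjoint is `L`.
Injectivity of `L` on `F (C ∩ ℒ)` is strict monotonicity. For surjectivity, given an interior point
`s` of `L K`, the function `f (Lᵀ τ) * exp (-⟪τ, s⟫)` has a positive maximum, which lies inside the
cone because `f` vanishes on its boundary; there the critical point equation is `L (F (Lᵀ τ)) = s`.
Since `F` is homogeneous of degree `-1`, `F` and `α F` have the same image on a cone. -/

/-- The value of a real polynomial at a complex point. -/
def evalC {d : ℕ} (f : MvPolynomial (Fin d) ℝ) (w : Fin d → ℂ) : ℂ :=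
  MvPolynomial.aeval w f

/-- A real vector as a complex one. -/
def toC {d : ℕ} (x : E d) : Fin d → ℂ := fun j => (x j : ℂ)

@[simp] lemma toC_add {d : ℕ} (x y : E d) : toC (x + y) = toC x + toC y := by
  ext j; simp [toC]

@[simp] lemma toC_smul {d : ℕ} (s : ℝ) (x : E d) : toC (s • x) = (s : ℂ) • toC x := by
  ext j; simp [toC]

lemma continuous_toC {d : ℕ} : Continuous (toC : E d → Fin d → ℂ) := by
  unfold toC; fun_prop

lemma evalC_toC {d : ℕ} (f : MvPolynomial (Fin d) ℝ) (x : E d) :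
    evalC f (toC x) = (fn f x : ℂ) := by
  unfold evalC toC fn
  have := MvPolynomial.aeval_algebraMap_apply (A := ℝ) ℂ (fun j => x j) f
  simpa [MvPolynomial.aeval_eq_eval, Function.comp_def] using this

lemma fnC_eq_evalC {d : ℕ} (f : MvPolynomial (Fin d) ℝ) (θ η : E d) (s : ℝ) :
    fnC f θ η s = evalC f (toC θ + (Complex.I * s) • toC η) := rfl

lemma continuous_evalC {d : ℕ} (f : MvPolynomial (Fin d) ℝ) : Continuous (evalC f) :=
  (AnalyticOnNhd.aeval_mvPolynomial (𝕜 := ℂ) (s := univ) (f := fun w : Fin d → ℂ => w)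
    (fun i => (ContinuousLinearMap.proj (R := ℂ) (φ := fun _ : Fin d => ℂ) i).analyticOnNhd _)
    f).continuousOn |> continuousOn_univ.mp

lemma evalC_smul {d p : ℕ} {f : MvPolynomial (Fin d) ℝ} (hf : f.IsHomogeneous p) (z : ℂ)
    (w : Fin d → ℂ) : evalC f (z • w) = z ^ p * evalC f w := by
  unfold evalC
  rw [MvPolynomial.aeval_def, MvPolynomial.eval₂_eq', MvPolynomial.aeval_def,
    MvPolynomial.eval₂_eq', Finset.mul_sum]
  refine Finset.sum_congr rfl fun m hm => ?_
  have hdeg : ∑ i, m i = p := by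
    have := hf (MvPolynomial.mem_support_iff.mp hm)
    rw [← this, Finsupp.weight_apply, Finsupp.sum_fintype] <;> simp
  simp only [Pi.smul_apply, smul_eq_mul, mul_pow, Finset.prod_mul_distrib, Finset.prod_pow_eq_pow_sum,
    hdeg]
  ring

lemma fn_smul {d p : ℕ} {f : MvPolynomial (Fin d) ℝ} (hf : f.IsHomogeneous p) (s : ℝ) (x : E d) :
    fn f (s • x) = s ^ p * fn f x := by
  have := evalC_smul hf s (toC x)
  rw [← toC_smul, evalC_toC, evalC_toC] at this
  exact_mod_cast this

lemma evalC_conj {d : ℕ} (f : MvPolynomial (Fin d) ℝ) (w : Fin d → ℂ) :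
    evalC f (fun j => (starRingEnd ℂ) (w j)) = (starRingEnd ℂ) (evalC f w) := by
  unfold evalC
  have := MvPolynomial.comp_aeval_apply (R := ℝ) (f := w) Complex.conjAe.toAlgHom f
  simpa using this.symm

lemma contDiff_fn {d : ℕ} (f : MvPolynomial (Fin d) ℝ) {n : WithTop ℕ∞} :
    ContDiff ℝ n (fn f) := by
  have h := AnalyticOnNhd.aeval_mvPolynomial (𝕜 := ℝ) (s := univ)
    (f := fun (x : E d) (j : Fin d) => x j)
    (fun i => (EuclideanSpace.proj i : E d →L[ℝ] ℝ).analyticOnNhd _) f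
  simp only [MvPolynomial.aeval_eq_eval] at h
  exact contDiffOn_univ.mp (h.contDiffOn uniqueDiffOn_univ)

lemma continuous_fn {d : ℕ} (f : MvPolynomial (Fin d) ℝ) : Continuous (fn f) :=
  (contDiff_fn f (n := 0)).continuous

lemma hasDerivAt_evalC {d : ℕ} (f : MvPolynomial (Fin d) ℝ) (w a : Fin d → ℂ) (z : ℂ) :
    HasDerivAt (fun z : ℂ => evalC f (w + z • a))
      (∑ j, a j * evalC (MvPolynomial.pderiv j f) (w + z • a)) z := by
  unfold evalC
  induction f using MvPolynomial.induction_on with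
  | C r => simpa using hasDerivAt_const _ _
  | add g h hg hh =>
    simp only [map_add, mul_add, Finset.sum_add_distrib]
    exact hg.add hh
  | mul_X g i hg =>
    have hX : HasDerivAt (fun z : ℂ => w i + z * a i) (a i) z := by
      simpa using ((hasDerivAt_id z).mul_const (a i)).const_add (w i)
    have := hg.mul hX
    simp only [map_mul, MvPolynomial.aeval_X, Derivation.leibniz, smul_eq_mul, map_add, Pi.add_apply,
      Pi.smul_apply, MvPolynomial.pderiv_X]
    refine this.congr_deriv ?_
    have hs : ∀ j, (MvPolynomial.aeval (w + z • a))
        ((Pi.single j 1 : Fin d → MvPolynomial (Fin d) ℝ) i) = if i = j then (1 : ℂ) else 0 := by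
      intro j
      by_cases h : i = j <;> simp [h]
    rw [Finset.sum_mul]
    have h1 : MvPolynomial.aeval (w + z • a) g * a i = ∑ j, a j * (MvPolynomial.aeval (w + z • a) g *
        (MvPolynomial.aeval (w + z • a)) ((Pi.single j 1 : Fin d → MvPolynomial (Fin d) ℝ) i)) := by
      simp [hs, mul_comm]
    rw [h1, ← Finset.sum_add_distrib]
    exact Finset.sum_congr rfl fun j _ => by ring

/-! ### Restriction to complex lines -/

/-- The polynomial `t ↦ f (w + t a)` for complex vectors `w`, `a`. -/
def linePoly {d : ℕ} (f : MvPolynomial (Fin d) ℝ) (w a : Fin d → ℂ) : Polynomial ℂ :=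
  MvPolynomial.aeval (fun j => Polynomial.C (w j) + Polynomial.C (a j) * Polynomial.X) f

lemma linePoly_eval {d : ℕ} (f : MvPolynomial (Fin d) ℝ) (w a : Fin d → ℂ) (t : ℂ) :
    (linePoly f w a).eval t = evalC f (w + t • a) := by
  unfold linePoly evalC
  have := MvPolynomial.comp_aeval_apply (R := ℝ)
    (f := fun j => Polynomial.C (w j) + Polynomial.C (a j) * Polynomial.X)
    ((Polynomial.aeval t).restrictScalars ℝ) f
  rw [AlgHom.restrictScalars_apply, Polynomial.coe_aeval_eq_eval] at this
  rw [this]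
  refine congrArg (fun v => MvPolynomial.aeval v f) (funext fun j => ?_)
  rw [AlgHom.restrictScalars_apply, Polynomial.coe_aeval_eq_eval]
  rw [Polynomial.eval_add, Polynomial.eval_mul, Polynomial.eval_C, Polynomial.eval_C,
    Polynomial.eval_X, mul_comm]
  rfl

lemma natDegree_prod_linear_le {d : ℕ} (w a : Fin d → ℂ) (m : Fin d → ℕ) (s : Finset (Fin d)) :
    (∏ i ∈ s, (Polynomial.C (w i) + Polynomial.C (a i) * Polynomial.X) ^ m i).natDegree
      ≤ ∑ i ∈ s, m i := by
  refine (Polynomial.natDegree_prod_le _ _).trans (Finset.sum_le_sum fun i _ => ?_)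
  refine Polynomial.natDegree_pow_le.trans ?_
  have : (Polynomial.C (w i) + Polynomial.C (a i) * Polynomial.X).natDegree ≤ 1 := by
    compute_degree
  nlinarith

/-- The coefficient is taken at the formal degree, since the true degree drops when some `a i` is
zero. -/
lemma coeff_prod_linear {d : ℕ} (w a : Fin d → ℂ) (m : Fin d → ℕ) (s : Finset (Fin d)) :
    (∏ i ∈ s, (Polynomial.C (w i) + Polynomial.C (a i) * Polynomial.X) ^ m i).coeff
      (∑ i ∈ s, m i) = ∏ i ∈ s, a i ^ m i := by
  induction s using Finset.induction_on with
  | empty => simp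
  | insert i s hi ih =>
    rw [Finset.prod_insert hi, Finset.sum_insert hi, Finset.prod_insert hi,
      Polynomial.coeff_mul_add_eq_of_natDegree_le _ (natDegree_prod_linear_le w a m s), ih]
    · congr 1
      have h1 : (Polynomial.C (w i) + Polynomial.C (a i) * Polynomial.X).natDegree ≤ 1 := by
        compute_degree
      have := Polynomial.coeff_pow_of_natDegree_le (m := m i) h1
      rw [mul_one] at this
      rw [this]
      simp
    · simpa using natDegree_prod_linear_le w a m {i}

lemma natDegree_linePoly_le {d p : ℕ} {f : MvPolynomial (Fin d) ℝ} (hf : f.IsHomogeneous p)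
    (w a : Fin d → ℂ) : (linePoly f w a).natDegree ≤ p := by
  unfold linePoly
  rw [MvPolynomial.aeval_def, MvPolynomial.eval₂_eq']
  refine Polynomial.natDegree_sum_le_of_forall_le _ _ fun m hm => ?_
  have hdeg : ∑ i, m i = p := by
    have := hf (MvPolynomial.mem_support_iff.mp hm)
    rw [← this, Finsupp.weight_apply, Finsupp.sum_fintype] <;> simp
  refine (Polynomial.natDegree_C_mul_le ((f.coeff m : ℝ) : ℂ) _).trans ?_
  rw [← hdeg]
  exact natDegree_prod_linear_le w a m _

lemma coeff_linePoly {d p : ℕ} {f : MvPolynomial (Fin d) ℝ} (hf : f.IsHomogeneous p)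
    (w a : Fin d → ℂ) : (linePoly f w a).coeff p = evalC f a := by
  unfold linePoly evalC
  rw [MvPolynomial.aeval_def, MvPolynomial.eval₂_eq', MvPolynomial.aeval_def,
    MvPolynomial.eval₂_eq', Polynomial.finsetSum_coeff]
  refine Finset.sum_congr rfl fun m hm => ?_
  have hdeg : ∑ i, m i = p := by
    have := hf (MvPolynomial.mem_support_iff.mp hm)
    rw [← this, Finsupp.weight_apply, Finsupp.sum_fintype] <;> simp
  rw [← hdeg, ← coeff_prod_linear w a m Finset.univ]
  exact Polynomial.coeff_C_mul (a := ((f.coeff m : ℝ) : ℂ)) _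

/-- The factorization of a homogeneous polynomial along a complex line whose direction is not a
zero. -/
lemma exists_factorization {d p : ℕ} {f : MvPolynomial (Fin d) ℝ} (hf : f.IsHomogeneous p)
    (w a : Fin d → ℂ) (ha : evalC f a ≠ 0) :
    ∃ r : Fin p → ℂ, ∀ t : ℂ, evalC f (w + t • a) = evalC f a * ∏ i, (t - r i) := by
  set P := linePoly f w a with hP
  have hc : P.coeff p = evalC f a := coeff_linePoly hf w a
  have hdeg : P.natDegree = p :=
    le_antisymm (natDegree_linePoly_le hf w a)
      (Polynomial.le_natDegree_of_ne_zero (by rw [hc]; exact ha))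
  have hsplit : P.Splits := IsAlgClosed.splits P
  have hcard : P.roots.toList.length = p := by
    rw [Multiset.length_toList, ← hdeg]
    exact hsplit.natDegree_eq_card_roots.symm
  have heq := hsplit.eq_prod_roots
  refine ⟨fun i => P.roots.toList.get (i.cast hcard.symm), fun t => ?_⟩
  rw [← linePoly_eval, ← hP]
  conv_lhs => rw [heq]
  rw [Polynomial.leadingCoeff, hdeg, hc, Polynomial.eval_mul, Polynomial.eval_C]
  congr 1
  rw [Polynomial.eval_multiset_prod, Multiset.map_map]
  simp only [Function.comp_def, Polynomial.eval_sub, Polynomial.eval_X, Polynomial.eval_C]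
  conv_lhs => rw [← Multiset.coe_toList P.roots]
  rw [Multiset.map_coe, Multiset.prod_coe, ← List.prod_ofFn]
  congr 1
  apply List.ext_getElem <;> simp [hcard]

/-- Roots along lines depend continuously on the line. -/
lemma eventually_exists_root {d p : ℕ} {f : MvPolynomial (Fin d) ℝ} (hf : f.IsHomogeneous p)
    (w a : Fin d → ℂ) (ha : evalC f a ≠ 0) (t₀ : ℂ) (h0 : evalC f (w + t₀ • a) = 0) {ε : ℝ}
    (hε : 0 < ε) : ∀ᶠ w' in 𝓝 w, ∃ t, ‖t - t₀‖ < ε ∧ evalC f (w' + t • a) = 0 := by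
  have hcont : Tendsto (fun w' => ‖evalC f (w' + t₀ • a)‖) (𝓝 w) (𝓝 0) := by
    have : Continuous fun w' => ‖evalC f (w' + t₀ • a)‖ :=
      ((continuous_evalC f).comp (continuous_id.add continuous_const)).norm
    simpa [h0] using this.tendsto w
  -- If all `p` roots stayed at distance at least `ε` from `t₀`, the value at `t₀` would be at least
  -- this large in norm, yet it tends to zero.
  have hpos : 0 < ‖evalC f a‖ * ε ^ p := mul_pos (norm_pos_iff.mpr ha) (pow_pos hε p)
  filter_upwards [hcont.eventually (gt_mem_nhds hpos)] with w' hw'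
  obtain ⟨r, hr⟩ := exists_factorization hf w' a ha
  by_contra! hcon
  have hge : ∀ i, ε ≤ ‖t₀ - r i‖ := by
    intro i
    by_contra! hlt
    refine hcon (r i) (by rwa [norm_sub_rev]) ?_
    rw [hr, Finset.prod_eq_zero (Finset.mem_univ i) (sub_self _), mul_zero]
  rw [hr, norm_mul, norm_prod] at hw'
  have : ε ^ p ≤ ∏ i, ‖t₀ - r i‖ := by
    calc ε ^ p = ∏ _i : Fin p, ε := by simp
      _ ≤ _ := Finset.prod_le_prod (fun _ _ => hε.le) fun i _ => hge i
  exact absurd hw' (not_lt.mpr (mul_le_mul_of_nonneg_left this (norm_nonneg _)))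

/-! ### The hyperbolicity cone as a connected component -/

section Component

variable {d : ℕ} {f : MvPolynomial (Fin d) ℝ}

lemma isOpen_ne_zero (f : MvPolynomial (Fin d) ℝ) : IsOpen {θ : E d | fn f θ ≠ 0} :=
  isOpen_ne_fun (continuous_fn f) continuous_const

lemma isOpen_hypCone (f : MvPolynomial (Fin d) ℝ) (τ : E d) : IsOpen (hypCone f τ) :=
  (isOpen_ne_zero f).connectedComponentIn

lemma fn_ne_zero_of_mem {τ θ : E d} (h : θ ∈ hypCone f τ) : fn f θ ≠ 0 :=
  connectedComponentIn_subset _ _ h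

lemma mem_hypCone_self {τ : E d} (h : fn f τ ≠ 0) : τ ∈ hypCone f τ :=
  mem_connectedComponentIn h

lemma hypCone_eq_of_mem {τ θ : E d} (h : θ ∈ hypCone f τ) : hypCone f θ = hypCone f τ :=
  (connectedComponentIn_eq h).symm

lemma mem_hypCone_of_segment {a b : E d} (h : segment ℝ a b ⊆ {θ | fn f θ ≠ 0}) :
    b ∈ hypCone f a :=
  (convex_segment a b).isPreconnected.subset_connectedComponentIn (left_mem_segment ℝ a b) h
    (right_mem_segment ℝ a b)

/-- The component of `θ` is open, hence meets the cone and coincides with it. Consequently `f`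
vanishes on the boundary of the cone. -/
lemma mem_hypCone_of_mem_closure {τ θ : E d} (h : θ ∈ closure (hypCone f τ))
    (hθ : fn f θ ≠ 0) : θ ∈ hypCone f τ := by
  obtain ⟨x, hx1, hx2⟩ := mem_closure_iff.mp h _ (isOpen_hypCone f θ) (mem_hypCone_self hθ)
  rw [← hypCone_eq_of_mem hx2, hypCone_eq_of_mem hx1]
  exact mem_hypCone_self hθ

lemma fn_pos_of_mem {τ θ : E d} (hτ : 0 < fn f τ) (h : θ ∈ hypCone f τ) : 0 < fn f θ := by
  by_contra! hle
  have hpre : IsPreconnected (hypCone f τ) := isPreconnected_connectedComponentIn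
  obtain ⟨x, hx, hx0⟩ := hpre.intermediate_value h (mem_hypCone_self hτ.ne')
    (continuous_fn f).continuousOn ⟨hle, hτ.le⟩
  exact fn_ne_zero_of_mem hx hx0

end Component

/-! ### Real-rootedness in all directions of the cone -/

/-- All complex zeros of `z ↦ f (x + z a)` are real, for all real points `x`. -/
def RealRootedAlong {d : ℕ} (f : MvPolynomial (Fin d) ℝ) (a : E d) : Prop :=
  ∀ (x : E d) (z : ℂ), evalC f (toC x + z • toC a) = 0 → z.im = 0

section RealRooted

variable {d p : ℕ} {f : MvPolynomial (Fin d) ℝ}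

lemma map_lineRestriction (f : MvPolynomial (Fin d) ℝ) (τ v : E d) :
    (lineRestriction f τ v).map (algebraMap ℝ ℂ) = linePoly f (toC v) (toC τ) := by
  have := MvPolynomial.comp_aeval_apply (R := ℝ)
    (f := fun j => Polynomial.C (v j) + Polynomial.C (τ j) * (Polynomial.X : Polynomial ℝ))
    (Polynomial.mapAlgHom (Algebra.ofId ℝ ℂ)) f
  unfold lineRestriction linePoly
  refine this.trans (congrArg (fun g => MvPolynomial.aeval g f) (funext fun j => ?_))
  rw [Polynomial.coe_mapAlgHom, Polynomial.map_add, Polynomial.map_mul, Polynomial.map_C,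
    Polynomial.map_C, Polynomial.map_X]
  rfl

/-- The degree is at most `p` and there are `p` real roots, so the polynomial splits over `ℝ` and no
other complex root remains. -/
lemma IsHyperbolic.realRootedAlong {e : E d} (hf : IsHyperbolic f p e) : RealRootedAlong f e := by
  intro x z hz
  have hmap := map_lineRestriction f e x
  have hne : linePoly f (toC x) (toC e) ≠ 0 := by
    intro h0
    have := coeff_linePoly hf.homogeneous (toC x) (toC e)
    rw [h0, Polynomial.coeff_zero, evalC_toC] at this
    exact hf.ne_zero (by exact_mod_cast this.symm)
  have hdeg : (lineRestriction f e x).natDegree ≤ p := by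
    rw [← Polynomial.natDegree_map (algebraMap ℝ ℂ), hmap]
    exact natDegree_linePoly_le hf.homogeneous _ _
  have hcard := hf.real_rooted x
  have hsplit : (lineRestriction f e x).Splits := by
    rw [Polynomial.splits_iff_card_roots]
    exact le_antisymm (Polynomial.card_roots' _) (hcard ▸ hdeg)
  have hroot : z ∈ ((lineRestriction f e x).map (algebraMap ℝ ℂ)).roots := by
    rw [hmap, Polynomial.mem_roots hne, Polynomial.IsRoot, linePoly_eval]
    exact hz
  rw [hsplit.roots_map, Multiset.mem_map] at hroot
  obtain ⟨r, -, rfl⟩ := hroot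
  simp

/-- Up to the positive factor `1 + t`, points of the ray `a + t e` are points of the segment from
`e` to `a`. -/
lemma fn_add_smul_ne_zero_of_segment (hom : f.IsHomogeneous p) {e a : E d}
    (h : ∀ u ∈ Icc (0 : ℝ) 1, fn f ((1 - u) • e + u • a) ≠ 0) {t : ℝ} (ht : 0 ≤ t) :
    fn f (a + t • e) ≠ 0 := by
  have h1 : (0 : ℝ) < 1 + t := by linarith
  have hx : a + t • e = (1 + t) • ((1 - (1 + t)⁻¹) • e + (1 + t)⁻¹ • a) := by
    rw [smul_add, smul_smul, smul_smul, mul_inv_cancel₀ h1.ne', one_smul, mul_sub,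
      mul_inv_cancel₀ h1.ne', add_comm]
    congr 2
    ring
  rw [hx, fn_smul hom]
  refine mul_ne_zero (pow_ne_zero _ h1.ne') (h _ ⟨by positivity, ?_⟩)
  exact inv_le_one_of_one_le₀ (by linarith)

/-- The points visible from `e` form an open set `A`, which is shown to be relatively closed in the
connected cone. A zero on the segment to a limit point `x` is a root `t > 0` of `f (x + t e)`; for
nearby `y ∈ A` there is a root within distance `t` of it, which is real by hypothesis and
nonnegative, against `fn_add_smul_ne_zero_of_segment`. -/
lemma segment_subset_of_mem_hypCone (hom : f.IsHomogeneous p) {e : E d} (he : fn f e ≠ 0)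
    (hr : RealRootedAlong f e) {a : E d} (ha : a ∈ hypCone f e) :
    ∀ u ∈ Icc (0 : ℝ) 1, fn f ((1 - u) • e + u • a) ≠ 0 := by
  set A : Set (E d) := {a | ∀ u ∈ Icc (0 : ℝ) 1, fn f ((1 - u) • e + u • a) ≠ 0} with hA
  have hopen : IsOpen A := by
    rw [isOpen_iff_mem_nhds]
    intro x hx
    refine isCompact_Icc.eventually_forall_of_forall_eventually (P := fun x u =>
      fn f ((1 - u) • e + u • x) ≠ 0) fun u hu => ?_
    have hc : Continuous fun q : E d × ℝ => fn f ((1 - q.2) • e + q.2 • q.1) :=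
      (continuous_fn f).comp (by fun_prop)
    exact (hc.continuousAt (x := (x, u))).eventually_ne (hx u hu)
  have heA : e ∈ A := by
    intro u _
    rw [← add_smul, sub_add_cancel, one_smul]
    exact he
  refine (isPreconnected_connectedComponentIn.subset_of_closure_inter_subset hopen
    ⟨e, mem_hypCone_self he, heA⟩ ?_) ha
  rintro x ⟨hxA, hxC⟩ u ⟨hu0, hu1⟩ hzero
  have hfx : fn f x ≠ 0 := fn_ne_zero_of_mem hxC
  have hu0' : 0 < u := lt_of_le_of_ne hu0 fun h => by
    subst h
    simp at hzero
    exact he hzero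
  have hu1' : u < 1 := lt_of_le_of_ne hu1 fun h => by
    subst h
    simp at hzero
    exact hfx hzero
  set t : ℝ := (1 - u) / u with ht
  have htpos : 0 < t := div_pos (by linarith) hu0'
  have hroot : fn f (x + t • e) = 0 := by
    have : (1 - u) • e + u • x = u • (x + t • e) := by
      rw [smul_add, smul_smul, ht, mul_div_cancel₀ _ hu0'.ne', add_comm]
    rw [this, fn_smul hom] at hzero
    exact (mul_eq_zero.mp hzero).resolve_left (pow_ne_zero _ hu0'.ne')
  have hev := eventually_exists_root hom (toC x) (toC e) (by rw [evalC_toC]; exact_mod_cast he)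
    (t : ℂ) (by rw [← toC_smul, ← toC_add, evalC_toC, hroot, Complex.ofReal_zero]) htpos
  have hev' := continuous_toC.continuousAt.eventually hev
  obtain ⟨y, ⟨z, hz, hz0⟩, hyA⟩ := (hev'.and_frequently (mem_closure_iff_frequently.mp hxA)).exists
  have him := hr y z hz0
  have hre : z = (z.re : ℂ) := Complex.ext rfl (by simpa using him)
  have hzpos : 0 ≤ z.re := by
    have h1 : |z.re - t| ≤ ‖z - t‖ := by simpa using Complex.abs_re_le_norm (z - t)
    have := (abs_lt.mp (h1.trans_lt hz)).1
    linarith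
  rw [hre, ← toC_smul, ← toC_add, evalC_toC] at hz0
  exact fn_add_smul_ne_zero_of_segment hom hyA hzpos (by exact_mod_cast hz0)

lemma fn_add_smul_ne_zero (hom : f.IsHomogeneous p) {e : E d} (he : fn f e ≠ 0)
    (hr : RealRootedAlong f e) {a : E d} (ha : a ∈ hypCone f e) {t : ℝ} (ht : 0 ≤ t) :
    fn f (a + t • e) ≠ 0 :=
  fn_add_smul_ne_zero_of_segment hom (segment_subset_of_mem_hypCone hom he hr ha) ht

/-- If `a` lies in the cone of `e`, then `f` has no zeros in `x + i δ e + t a` with `t` in the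
closed upper half plane. -/
lemma evalC_ne_zero_of_im_nonneg (hom : f.IsHomogeneous p) {e : E d} (he : fn f e ≠ 0)
    (hr : RealRootedAlong f e) {a : E d} (ha : a ∈ hypCone f e) (x : E d) {δ : ℝ} (hδ : 0 < δ)
    {t : ℂ} (ht : 0 ≤ t.im) : evalC f (toC x + (Complex.I * δ) • toC e + t • toC a) ≠ 0 := by
  have hfa : evalC f (toC a) ≠ 0 := by
    rw [evalC_toC]; exact_mod_cast fn_ne_zero_of_mem ha
  -- Deform `x` to `0` through `s x` and follow the zeros `t` in the closed upper half plane. None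
  -- is real, by real-rootedness along `e`, and they stay bounded because `f a ≠ 0`. So a least `s`
  -- with such a zero exists if there is any at `s = 1`.
  set w : ℝ → Fin d → ℂ := fun s => (s : ℂ) • toC x + (Complex.I * δ) • toC e with hw
  have hwc : Continuous w := by fun_prop
  set Z : Set (ℝ × ℂ) := {q | q.1 ∈ Icc (0 : ℝ) 1 ∧ 0 ≤ q.2.im ∧
    evalC f (w q.1 + q.2 • toC a) = 0} with hZ
  have hnoreal : ∀ q ∈ Z, 0 < q.2.im := by
    rintro ⟨s, t⟩ ⟨-, h1, h2⟩
    refine lt_of_le_of_ne h1 fun h => ?_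
    have hre : t = (t.re : ℂ) := Complex.ext rfl (by simpa using h.symm)
    have : w s + t • toC a = toC (s • x + t.re • a) + (Complex.I * δ) • toC e := by
      rw [hre, hw]
      simp only [toC_add, toC_smul, Complex.ofReal_re]
      abel
    simp only at h2
    rw [this] at h2
    have := hr _ _ h2
    simp at this
    exact hδ.ne' this
  have hZclosed : IsClosed Z := by
    refine (isClosed_Icc.preimage continuous_fst).inter
      ((isClosed_le continuous_const (Complex.continuous_im.comp continuous_snd)).inter
        (isClosed_eq ((continuous_evalC f).comp ?_) continuous_const))
    fun_prop
  have hZbdd : ∃ R, Z ⊆ Icc (0 : ℝ) 1 ×ˢ Metric.closedBall (0 : ℂ) R := by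
    obtain ⟨ε, hε, hball⟩ := Metric.eventually_nhds_iff.mp
      ((continuous_evalC f).continuousAt.eventually_ne hfa)
    obtain ⟨M, hM⟩ := (isCompact_Icc (a := (0 : ℝ)) (b := 1)).exists_bound_of_continuousOn
      hwc.continuousOn
    refine ⟨M / ε, ?_⟩
    rintro ⟨s, t⟩ ⟨hs, -, h2⟩
    refine ⟨hs, ?_⟩
    rw [mem_closedBall_zero_iff]
    by_contra! hlt
    have hM0 : 0 ≤ M := (norm_nonneg _).trans (hM s hs)
    have htpos : 0 < ‖t‖ := lt_of_le_of_lt (by positivity) hlt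
    have ht0 : t ≠ 0 := norm_pos_iff.mp htpos
    have heq : w s + t • toC a = t • (toC a + t⁻¹ • w s) := by
      rw [smul_add, smul_smul, mul_inv_cancel₀ ht0, one_smul, add_comm]
    simp only at h2
    rw [heq, evalC_smul hom] at h2
    refine hball (y := toC a + t⁻¹ • w s) ?_
      ((mul_eq_zero.mp h2).resolve_left (pow_ne_zero _ ht0))
    rw [dist_eq_norm, add_sub_cancel_left, norm_smul, norm_inv, inv_mul_lt_iff₀ htpos]
    calc ‖w s‖ ≤ M := hM s hs
      _ = (M / ε) * ε := by field_simp
      _ < ‖t‖ * ε := mul_lt_mul_of_pos_right hlt hε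
  obtain ⟨R, hR⟩ := hZbdd
  have hZcomp : IsCompact Z :=
    (isCompact_Icc.prod (isCompact_closedBall _ _)).of_isClosed_subset hZclosed hR
  intro hzero
  have hne : (Prod.fst '' Z).Nonempty := ⟨1, (1, t), ⟨by simp, ht, by simpa [hw] using hzero⟩, rfl⟩
  obtain ⟨s, ⟨⟨s', t'⟩, hmem, rfl⟩, hleast⟩ := (hZcomp.image continuous_fst).exists_isLeast hne
  simp only at hleast
  have him := hnoreal _ hmem
  obtain ⟨⟨hs0, hs1⟩, -, hz⟩ := hmem
  simp only at hs0 hs1 hz him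
  rcases hs0.eq_or_lt with h0 | hspos
  -- At `s = 0` the zero gives a root `l` of `f (a + l e)` with `t' l = i δ`. Such an `l` is a
  -- negative real, so `t'` would lie in the lower half plane.
  · subst h0
    have ht0 : t' ≠ 0 := by
      rintro rfl
      simp at him
    have heq : w 0 + t' • toC a = t' • (toC a + (t'⁻¹ * (Complex.I * δ)) • toC e) := by
      rw [smul_add, smul_smul, ← mul_assoc, mul_inv_cancel₀ ht0, one_mul, add_comm]
      simp [hw]
    rw [heq, evalC_smul hom] at hz
    have hz' := (mul_eq_zero.mp hz).resolve_left (pow_ne_zero _ ht0)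
    have him' := hr _ _ hz'
    set l : ℂ := t'⁻¹ * (Complex.I * δ) with hl
    have hre : l = (l.re : ℂ) := Complex.ext rfl (by simpa using him')
    rw [hre, ← toC_smul, ← toC_add, evalC_toC] at hz'
    have hneg : l.re < 0 := by
      by_contra! h
      exact fn_add_smul_ne_zero hom he hr ha h (by exact_mod_cast hz')
    have hprod : t' * l = Complex.I * δ := by
      rw [hl, ← mul_assoc, mul_inv_cancel₀ ht0, one_mul]
    have := congrArg Complex.im hprod
    rw [hre] at this
    simp at this
    nlinarith
  -- For `s' > 0` the root persists in the upper half plane for slightly smaller `s`, against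
  -- minimality.
  · have hev := eventually_exists_root hom (w s') (toC a) hfa t' hz him
    have hev' : ∀ᶠ s in 𝓝[<] s', ∃ t, ‖t - t'‖ < t'.im ∧ evalC f (w s + t • toC a) = 0 :=
      (hwc.continuousAt.eventually hev).filter_mono nhdsWithin_le_nhds
    have hpos : ∀ᶠ s in 𝓝[<] s', 0 < s :=
      (lt_mem_nhds hspos).filter_mono nhdsWithin_le_nhds
    obtain ⟨s, ⟨⟨t, h1, h2⟩, h3⟩, h4⟩ := ((hev'.and hpos).and self_mem_nhdsWithin).exists
    have h4' : s < s' := h4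
    refine absurd (hleast ⟨(s, t), ⟨⟨h3.le, (h4'.trans_le hs1).le⟩, ?_, h2⟩, rfl⟩) (not_le.mpr h4')
    have := Complex.abs_im_le_norm (t - t')
    rw [Complex.sub_im] at this
    have := (abs_lt.mp (this.trans_lt h1)).1
    simp only
    linarith

/-- Gårding's theorem: `f` is real-rooted along every direction of its hyperbolicity cone. -/
lemma realRootedAlong_of_mem (hom : f.IsHomogeneous p) {e : E d} (he : fn f e ≠ 0)
    (hr : RealRootedAlong f e) {a : E d} (ha : a ∈ hypCone f e) : RealRootedAlong f a := by
  have hfa : evalC f (toC a) ≠ 0 := by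
    rw [evalC_toC]; exact_mod_cast fn_ne_zero_of_mem ha
  -- A zero in the open upper half plane would survive the perturbation of `x` to `x + i δ e`, where
  -- none exist. The lower half plane follows by conjugation.
  have key : ∀ (x : E d) (z : ℂ), evalC f (toC x + z • toC a) = 0 → ¬ 0 < z.im := by
    intro x z hz him
    have hev := eventually_exists_root hom (toC x) (toC a) hfa z hz him
    have hc : ContinuousAt (fun δ : ℝ => toC x + (Complex.I * δ) • toC e) 0 := by fun_prop
    have hlim : Tendsto (fun δ : ℝ => toC x + (Complex.I * δ) • toC e) (𝓝[>] 0) (𝓝 (toC x)) := by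
      have := hc.tendsto
      simp only [Complex.ofReal_zero, mul_zero, zero_smul, add_zero] at this
      exact this.mono_left nhdsWithin_le_nhds
    obtain ⟨δ, ⟨t, ht1, ht2⟩, hδ⟩ := ((hlim.eventually hev).and self_mem_nhdsWithin).exists
    refine evalC_ne_zero_of_im_nonneg hom he hr ha x hδ ?_ ht2
    have := Complex.abs_im_le_norm (t - z)
    rw [Complex.sub_im] at this
    have := (abs_lt.mp (this.trans_lt ht1)).1
    linarith
  intro x z hz
  refine le_antisymm (not_lt.mp (key x z hz)) (not_lt.mp fun hneg => ?_)
  refine key x ((starRingEnd ℂ) z) ?_ (by simpa using hneg)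
  have := evalC_conj f (toC x + z • toC a)
  rw [hz, map_zero] at this
  rw [← this]
  congr 1
  ext j
  simp [toC]

end RealRooted

/-! ### Convexity and factorization -/

section Hyperbolic

variable {d p : ℕ} {f : MvPolynomial (Fin d) ℝ} {e : E d}

lemma IsHyperbolic.realRootedAlong_of_mem (hf : IsHyperbolic f p e) {a : E d}
    (ha : a ∈ hypCone f e) : RealRootedAlong f a :=
  HypExp.realRootedAlong_of_mem hf.homogeneous hf.ne_zero hf.realRootedAlong ha

/-- The cone is star-shaped about `e`, and by Gårding's theorem each of its points can play the role
of `e`. -/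
lemma IsHyperbolic.convex_hypCone (hf : IsHyperbolic f p e) : Convex ℝ (hypCone f e) := by
  rw [convex_iff_segment_subset]
  intro a ha b hb
  have hseg : segment ℝ a b ⊆ {θ | fn f θ ≠ 0} := by
    rw [segment_eq_image]
    rintro _ ⟨u, hu, rfl⟩
    exact segment_subset_of_mem_hypCone hf.homogeneous (fn_ne_zero_of_mem ha)
      (hf.realRootedAlong_of_mem ha) (by rwa [hypCone_eq_of_mem ha]) u hu
  rw [← hypCone_eq_of_mem ha]
  exact (convex_segment a b).isPreconnected.subset_connectedComponentIn
    (left_mem_segment ℝ a b) hseg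

lemma IsHyperbolic.smul_mem (hf : IsHyperbolic f p e) {a : E d} (ha : a ∈ hypCone f e) {s : ℝ}
    (hs : 0 < s) : s • a ∈ hypCone f e := by
  rw [← hypCone_eq_of_mem ha]
  refine mem_hypCone_of_segment ?_
  rw [segment_eq_image]
  rintro _ ⟨u, ⟨hu0, hu1⟩, rfl⟩
  have : (1 - u) • a + u • s • a = ((1 - u) + u * s) • a := by rw [add_smul, smul_smul]
  simp only [mem_ofPred_eq]
  rw [this, fn_smul hf.homogeneous]
  refine mul_ne_zero (pow_ne_zero _ ?_) (fn_ne_zero_of_mem ha)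
  rcases hu0.eq_or_lt with rfl | h
  · simp
  · have := mul_pos h hs
    linarith

lemma IsHyperbolic.add_mem (hf : IsHyperbolic f p e) {a b : E d} (ha : a ∈ hypCone f e)
    (hb : b ∈ hypCone f e) : a + b ∈ hypCone f e := by
  have h := hf.convex_hypCone ha hb (a := 1 / 2) (b := 1 / 2) (by norm_num) (by norm_num)
    (by norm_num)
  have := hf.smul_mem h (s := 2) (by norm_num)
  rwa [smul_add, smul_smul, smul_smul, mul_one_div_cancel (by norm_num), one_smul, one_smul] at this

/-- The factorization of `f` along complex lines through a point `a` of the cone, with real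
direction. -/
lemma IsHyperbolic.exists_factorization (hf : IsHyperbolic f p e) {a : E d}
    (ha : a ∈ hypCone f e) (b : E d) :
    ∃ r : Fin p → ℝ, ∀ z : ℂ,
      evalC f (toC a + z • toC b) = fn f a * ∏ j, (1 - z * (r j : ℂ)) := by
  have hfa : evalC f (toC a) ≠ 0 := by
    rw [evalC_toC]; exact_mod_cast fn_ne_zero_of_mem ha
  -- The `r j` are the roots of `t ↦ f (b + t a)`, to be used at `t = z⁻¹`. Roots equal to zero are
  -- harmless, so `f b` may vanish.
  obtain ⟨r, hr⟩ := HypExp.exists_factorization hf.homogeneous (toC b) (toC a) hfa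
  have him : ∀ j, (r j).im = 0 := fun j =>
    hf.realRootedAlong_of_mem ha b (r j) (by
      rw [hr, Finset.prod_eq_zero (Finset.mem_univ j) (sub_self _), mul_zero])
  have hre : ∀ j, r j = ((r j).re : ℂ) := fun j => Complex.ext rfl (by simpa using him j)
  refine ⟨fun j => (r j).re, fun z => ?_⟩
  simp_rw [← hre]
  rcases eq_or_ne z 0 with rfl | hz
  · simp [evalC_toC]
  · have heq : toC a + z • toC b = z • (toC b + z⁻¹ • toC a) := by
      rw [smul_add, smul_smul, mul_inv_cancel₀ hz, one_smul, add_comm]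
    rw [heq, evalC_smul hf.homogeneous, hr, evalC_toC, mul_left_comm]
    congr 1
    have : z ^ p = ∏ _j : Fin p, z := by simp
    rw [this, ← Finset.prod_mul_distrib]
    refine Finset.prod_congr rfl fun j _ => ?_
    rw [mul_sub, mul_inv_cancel₀ hz]

lemma fn_eq_of_factorization {a b : E d} {r : Fin p → ℝ}
    (hr : ∀ z : ℂ, evalC f (toC a + z • toC b) = fn f a * ∏ j, (1 - z * (r j : ℂ))) (s : ℝ) :
    fn f (a + s • b) = fn f a * ∏ j, (1 - s * r j) := by
  have := hr s
  rw [← toC_smul, ← toC_add, evalC_toC] at this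
  exact_mod_cast this

/-- A quantitative form of pointedness. -/
lemma IsHyperbolic.exists_pointed_bound (hf : IsHyperbolic f p e)
    (hpt : IsPointed (hypCone f e)) :
    ∃ δ > 0, ∀ a η : E d, a + η ∈ hypCone f e → a - η ∈ hypCone f e → δ * ‖η‖ ≤ ‖a‖ := by
  set K := closure (hypCone f e) with hK
  have hKne : K.Nonempty := ⟨e, subset_closure (mem_hypCone_self hf.ne_zero)⟩
  -- By pointedness `g` is positive on the unit sphere. If `a ± η` lie in the cone, both `η / ‖η‖`
  -- and its negative are within `‖a‖ / ‖η‖` of it.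
  set g : E d → ℝ := fun η => Metric.infDist η K + Metric.infDist (-η) K with hg
  have hgc : Continuous g :=
    (Metric.continuous_infDist_pt K).add ((Metric.continuous_infDist_pt K).comp continuous_neg)
  have hmin : ∃ δ > 0, ∀ η ∈ Metric.sphere (0 : E d) 1, δ ≤ g η := by
    rcases (Metric.sphere (0 : E d) 1).eq_empty_or_nonempty with h | h
    · exact ⟨1, one_pos, fun η hη => by simp [h] at hη⟩
    · obtain ⟨x, hx, hxmin⟩ := (isCompact_sphere (0 : E d) 1).exists_isMinOn h hgc.continuousOn
      refine ⟨g x, ?_, fun η hη => hxmin hη⟩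
      refine lt_of_le_of_ne (add_nonneg Metric.infDist_nonneg Metric.infDist_nonneg) fun h0 => ?_
      have h1 : Metric.infDist x K = 0 := by
        have := Metric.infDist_nonneg (x := x) (s := K)
        have := Metric.infDist_nonneg (x := -x) (s := K)
        simp only [hg] at h0
        linarith
      have h2 : Metric.infDist (-x) K = 0 := by
        simp only [hg] at h0
        linarith
      have hx0 := hpt x ((isClosed_closure.mem_iff_infDist_zero hKne).mpr h1)
        ((isClosed_closure.mem_iff_infDist_zero hKne).mpr h2)
      rw [hx0] at hx
      simp at hx
  obtain ⟨δ, hδ, hδg⟩ := hmin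
  refine ⟨δ / 2, by positivity, fun a η h1 h2 => ?_⟩
  rcases eq_or_ne η 0 with rfl | hη
  · simp
  have hn : 0 < ‖η‖ := norm_pos_iff.mpr hη
  have hs := hδg (‖η‖⁻¹ • η) (by simp [norm_smul, hn.ne'])
  have e1 : Metric.infDist (‖η‖⁻¹ • η) K ≤ ‖η‖⁻¹ * ‖a‖ := by
    refine (Metric.infDist_le_dist_of_mem
      (subset_closure (hf.smul_mem h1 (inv_pos.mpr hn)))).trans (le_of_eq ?_)
    rw [dist_eq_norm, smul_add, sub_add_cancel_right, norm_neg, norm_smul, norm_inv, norm_norm]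
  have e2 : Metric.infDist (-(‖η‖⁻¹ • η)) K ≤ ‖η‖⁻¹ * ‖a‖ := by
    refine (Metric.infDist_le_dist_of_mem
      (subset_closure (hf.smul_mem h2 (inv_pos.mpr hn)))).trans (le_of_eq ?_)
    rw [dist_eq_norm, smul_sub, sub_eq_add_neg, sub_eq_add_neg, neg_add, neg_neg, add_left_comm,
      neg_add_cancel, add_zero, norm_neg, norm_smul, norm_inv, norm_norm]
  have : δ ≤ 2 * (‖η‖⁻¹ * ‖a‖) := by
    simp only [hg] at hs
    linarith
  have h3 : 2 * (‖η‖⁻¹ * ‖a‖) * ‖η‖ = 2 * ‖a‖ := by field_simp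
  nlinarith

/-- If the roots of `f` along `b`, seen from `a`, are smaller than `ρ`, then `‖b‖` is controlled by
`ρ` and `‖a‖`. -/
lemma IsHyperbolic.exists_root_bound (hf : IsHyperbolic f p e) (hpt : IsPointed (hypCone f e)) :
    ∃ δ > 0, ∀ a ∈ hypCone f e, ∀ (b : E d) (r : Fin p → ℝ),
      (∀ s : ℝ, fn f (a + s • b) = fn f a * ∏ j, (1 - s * r j)) →
      ∀ ρ > 0, (∀ j, |r j| < ρ) → δ * ‖b‖ ≤ ρ * ‖a‖ := by
  obtain ⟨δ, hδ, h⟩ := hf.exists_pointed_bound hpt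
  refine ⟨δ, hδ, fun a ha b r hr ρ hρ hlt => ?_⟩
  -- The zeros on this line sit at the `1 / r j`, beyond distance `ρ⁻¹`. So the points `a ± ρ⁻¹ b`
  -- are still in the cone, and the pointedness bound applies to them.
  have hmem : ∀ s : ℝ, |s| ≤ ρ⁻¹ → a + s • b ∈ hypCone f e := by
    intro s hs
    rw [← hypCone_eq_of_mem ha]
    refine mem_hypCone_of_segment ?_
    rw [segment_eq_image']
    rintro _ ⟨u, ⟨hu0, hu1⟩, rfl⟩
    simp only [mem_ofPred_eq, add_sub_cancel_left]
    rw [smul_smul, hr]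
    refine mul_ne_zero (fn_ne_zero_of_mem ha) (Finset.prod_ne_zero_iff.mpr fun j _ h0 => ?_)
    have h1 : |u * s * r j| = 1 := by
      rw [← sub_eq_zero.mp h0, abs_one]
    rw [abs_mul, abs_mul, abs_of_nonneg hu0] at h1
    have h2 : |s| * |r j| < 1 := by
      calc |s| * |r j| ≤ ρ⁻¹ * |r j| := mul_le_mul_of_nonneg_right hs (abs_nonneg _)
        _ < ρ⁻¹ * ρ := mul_lt_mul_of_pos_left (hlt j) (inv_pos.mpr hρ)
        _ = 1 := inv_mul_cancel₀ hρ.ne'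
    have h3 : 0 ≤ |s| * |r j| := by positivity
    nlinarith
  have h1 := hmem ρ⁻¹ (abs_of_pos (inv_pos.mpr hρ)).le
  have h2 := hmem (-ρ⁻¹) (by rw [abs_neg, abs_of_pos (inv_pos.mpr hρ)])
  rw [neg_smul, ← sub_eq_add_neg] at h2
  have := h a _ h1 h2
  rw [norm_smul, Real.norm_of_nonneg (inv_pos.mpr hρ).le, mul_left_comm, inv_mul_le_iff₀ hρ] at this
  exact this

end Hyperbolic

/-! ### The gradient of `log f` -/

section Gradient

variable {d p : ℕ} {f : MvPolynomial (Fin d) ℝ} {e : E d}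

lemma mem_dualCone {C : Set (E d)} {σ : E d} : σ ∈ dualCone C ↔ ∀ θ ∈ C, 0 ≤ ⟪θ, σ⟫ := by
  rw [dualCone, SetLike.mem_coe, ProperCone.mem_innerDual]

lemma isClosed_dualCone (C : Set (E d)) : IsClosed (dualCone C) :=
  (ProperCone.innerDual C).isClosed

lemma convex_dualCone (C : Set (E d)) : Convex ℝ (dualCone C) :=
  (ProperCone.innerDual C).convex

lemma inner_nonneg_of_mem_closure {C : Set (E d)} {θ σ : E d} (hθ : θ ∈ closure C)
    (hσ : σ ∈ dualCone C) : 0 ≤ ⟪θ, σ⟫ :=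
  closure_minimal (t := {x | 0 ≤ ⟪x, σ⟫}) (mem_dualCone.mp hσ)
    (isClosed_le continuous_const (continuous_id.inner continuous_const)) hθ

lemma differentiableAt_log_fn {θ : E d} (h : fn f θ ≠ 0) :
    DifferentiableAt ℝ (fun x => Real.log (fn f x)) θ :=
  ((contDiff_fn f (n := 1)).differentiable one_ne_zero θ).log h

lemma hasDerivAt_log_fn_line (a b : E d) {s : ℝ} (h : fn f (a + s • b) ≠ 0) :
    HasDerivAt (fun t : ℝ => Real.log (fn f (a + t • b))) ⟪gradLog f (a + s • b), b⟫ s := by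
  have hg : HasFDerivAt (fun x => Real.log (fn f x))
      (InnerProductSpace.toDual ℝ (E d) (gradLog f (a + s • b))) (a + s • b) :=
    (differentiableAt_log_fn h).hasGradientAt.hasFDerivAt
  have hl : HasDerivAt (fun t : ℝ => a + t • b) b s := by
    simpa using ((hasDerivAt_id s).smul_const b).const_add a
  exact hg.comp_hasDerivAt s hl

lemma inner_gradLog_of_factorization {a b : E d} {r : Fin p → ℝ} (ha : fn f a ≠ 0)
    (hr : ∀ s : ℝ, fn f (a + s • b) = fn f a * ∏ j, (1 - s * r j)) {s : ℝ}
    (h : fn f (a + s • b) ≠ 0) :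
    ⟪gradLog f (a + s • b), b⟫ = -∑ j, r j / (1 - s * r j) := by
  have hne : ∀ j, 1 - s * r j ≠ 0 := by
    rw [hr] at h
    exact fun j => Finset.prod_ne_zero_iff.mp (right_ne_zero_of_mul h) j (Finset.mem_univ j)
  have h1 := hasDerivAt_log_fn_line a b h
  have h2 : HasDerivAt (fun t : ℝ => Real.log (fn f a) + ∑ j, Real.log (1 - t * r j))
      (∑ j, -r j / (1 - s * r j)) s := by
    refine HasDerivAt.const_add _ (HasDerivAt.fun_sum fun j _ => ?_)
    have : HasDerivAt (fun t : ℝ => 1 - t * r j) (-r j) s := by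
      simpa using ((hasDerivAt_id s).mul_const (r j)).const_sub 1
    exact this.log (hne j)
  have hc : Continuous fun t : ℝ => fn f (a + t • b) := (continuous_fn f).comp (by fun_prop)
  have heq : (fun t : ℝ => Real.log (fn f (a + t • b))) =ᶠ[𝓝 s]
      fun t : ℝ => Real.log (fn f a) + ∑ j, Real.log (1 - t * r j) := by
    filter_upwards [hc.continuousAt.eventually_ne h] with t ht
    rw [hr] at ht
    rw [hr, Real.log_mul ha (right_ne_zero_of_mul ht), Real.log_prod]
    exact fun j hj => Finset.prod_ne_zero_iff.mp (right_ne_zero_of_mul ht) j hj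
  rw [h1.unique (h2.congr_of_eventuallyEq heq), ← Finset.sum_neg_distrib]
  exact Finset.sum_congr rfl fun j _ => neg_div _ _

/-- For `b` in the cone the ray `a + s b`, `s ≥ 0`, meets no zero, so all roots `r j` are
nonpositive and their absolute values sum to `⟪gradLog f a, b⟫`. Each is thus bounded by that
pairing, and the root bound controls `‖b‖`. -/
lemma IsHyperbolic.exists_gradLog_bound (hf : IsHyperbolic f p e)
    (hpt : IsPointed (hypCone f e)) :
    ∃ δ > 0, ∀ a ∈ hypCone f e, ∀ b ∈ hypCone f e,
      δ * ‖b‖ ≤ (1 + ‖a‖) * ⟪gradLog f a, b⟫ := by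
  obtain ⟨δ, hδ, h⟩ := hf.exists_root_bound hpt
  refine ⟨δ, hδ, fun a ha b hb => ?_⟩
  obtain ⟨r, hr⟩ := hf.exists_factorization ha b
  have hr' := fn_eq_of_factorization hr
  have hfa := fn_ne_zero_of_mem ha
  have hneg : ∀ j, r j ≤ 0 := by
    intro j
    by_contra! hpos
    refine fn_ne_zero_of_mem (hf.add_mem ha (hf.smul_mem hb (inv_pos.mpr hpos))) ?_
    rw [hr', Finset.prod_eq_zero (Finset.mem_univ j), mul_zero]
    rw [inv_mul_cancel₀ hpos.ne', sub_self]
  have hinner : ⟪gradLog f a, b⟫ = -∑ j, r j := by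
    simpa using inner_gradLog_of_factorization hfa hr' (s := 0) (by simpa using hfa)
  have hS : ∀ j, |r j| ≤ ⟪gradLog f a, b⟫ := by
    intro j
    rw [hinner, abs_of_nonpos (hneg j), ← Finset.sum_neg_distrib]
    exact Finset.single_le_sum (f := fun j => -r j) (fun i _ => neg_nonneg.mpr (hneg i))
      (Finset.mem_univ j)
  have hS0 : 0 ≤ ⟪gradLog f a, b⟫ := by
    rw [hinner]
    exact neg_nonneg.mpr (Finset.sum_nonpos fun j _ => hneg j)
  have hle : δ * ‖b‖ ≤ ⟪gradLog f a, b⟫ * ‖a‖ := by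
    -- The root bound asks for strict inequalities and `ρ > 0`, so it is used for larger `ρ` and
    -- passed to the limit.
    have hlim : Tendsto (fun ρ : ℝ => ρ * ‖a‖) (𝓝[>] ⟪gradLog f a, b⟫)
        (𝓝 (⟪gradLog f a, b⟫ * ‖a‖)) :=
      ((continuous_id.mul continuous_const).tendsto _).mono_left nhdsWithin_le_nhds
    refine ge_of_tendsto hlim ?_
    filter_upwards [self_mem_nhdsWithin] with ρ hρ
    exact h a ha b r hr' ρ (hS0.trans_lt hρ) fun j => (hS j).trans_lt hρ
  nlinarith

lemma IsHyperbolic.gradLog_mem_interior (hf : IsHyperbolic f p e)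
    (hpt : IsPointed (hypCone f e)) {a : E d} (ha : a ∈ hypCone f e) :
    gradLog f a ∈ interior (dualCone (hypCone f e)) := by
  obtain ⟨δ, hδ, h⟩ := hf.exists_gradLog_bound hpt
  rw [mem_interior_iff_mem_nhds, Metric.mem_nhds_iff]
  refine ⟨δ / (1 + ‖a‖), by positivity, fun σ hσ => mem_dualCone.mpr fun b hb => ?_⟩
  have h1 := h a ha b hb
  rw [mem_ball_iff_norm] at hσ
  have h2 : |⟪b, σ - gradLog f a⟫| ≤ ‖b‖ * ‖σ - gradLog f a‖ := abs_real_inner_le_norm _ _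
  have h3 : ⟪b, σ⟫ = ⟪gradLog f a, b⟫ + ⟪b, σ - gradLog f a⟫ := by
    rw [inner_sub_right, real_inner_comm b]
    ring
  have h4 := (abs_le.mp h2).1
  have h5 : ‖b‖ * ‖σ - gradLog f a‖ ≤ ‖b‖ * (δ / (1 + ‖a‖)) :=
    mul_le_mul_of_nonneg_left hσ.le (norm_nonneg _)
  have h6 : ‖b‖ * (δ / (1 + ‖a‖)) ≤ ⟪gradLog f a, b⟫ := by
    rw [← mul_div_assoc, div_le_iff₀ (by positivity)]
    linarith
  linarith

/-- `∇ log f` is strictly monotone decreasing, i.e. `log f` is strictly concave. -/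
lemma IsHyperbolic.inner_gradLog_sub_neg (hf : IsHyperbolic f p e)
    (hpt : IsPointed (hypCone f e)) {a a' : E d} (ha : a ∈ hypCone f e) (ha' : a' ∈ hypCone f e)
    (hne : a ≠ a') : ⟪gradLog f a' - gradLog f a, a' - a⟫ < 0 := by
  obtain ⟨δ, hδ, h⟩ := hf.exists_root_bound hpt
  set b := a' - a with hb
  obtain ⟨r, hr⟩ := hf.exists_factorization ha b
  have hr' := fn_eq_of_factorization hr
  have hfa := fn_ne_zero_of_mem ha
  have hab : a + (1 : ℝ) • b = a' := by rw [one_smul, hb]; abel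
  -- Otherwise the zero at `1 / r j` would lie on the segment from `a` to `a'`.
  have hlt : ∀ j, r j < 1 := by
    intro j
    by_contra! hge
    have hpos : 0 < r j := by linarith
    have hmem : a + (r j)⁻¹ • b ∈ hypCone f e :=
      hf.convex_hypCone.add_smul_sub_mem ha ha' ⟨(inv_pos.mpr hpos).le, inv_le_one_of_one_le₀ hge⟩
    refine fn_ne_zero_of_mem hmem ?_
    rw [hr', Finset.prod_eq_zero (Finset.mem_univ j), mul_zero]
    rw [inv_mul_cancel₀ hpos.ne', sub_self]
  have h0 : ⟪gradLog f a, b⟫ = -∑ j, r j := by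
    simpa using inner_gradLog_of_factorization hfa hr' (s := 0) (by simpa using hfa)
  have h1 : ⟪gradLog f a', b⟫ = -∑ j, r j / (1 - r j) := by
    have := inner_gradLog_of_factorization hfa hr' (s := 1)
      (by rw [hab]; exact fn_ne_zero_of_mem ha')
    rw [hab] at this
    simpa using this
  rw [inner_sub_left, h0, h1, neg_sub_neg, ← Finset.sum_sub_distrib]
  have hterm : ∀ j, r j - r j / (1 - r j) = -(r j ^ 2 / (1 - r j)) := by
    intro j
    have : 1 - r j ≠ 0 := by linarith [hlt j]
    field_simp
    ring
  simp_rw [hterm, Finset.sum_neg_distrib, neg_lt_zero]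
  have hnn : ∀ j, 0 ≤ r j ^ 2 / (1 - r j) := fun j =>
    div_nonneg (sq_nonneg _) (by linarith [hlt j])
  refine lt_of_le_of_ne (Finset.sum_nonneg fun j _ => hnn j) fun hzero => ?_
  -- If all roots vanish, the root bound holds with every `ρ > 0`; the `ρ` below is small enough to
  -- contradict `b ≠ 0`.
  have hall : ∀ j, r j = 0 := by
    intro j
    have := (Finset.sum_eq_zero_iff_of_nonneg fun j _ => hnn j).mp hzero.symm j (Finset.mem_univ j)
    rcases div_eq_zero_iff.mp this with h | h
    · exact pow_eq_zero_iff two_ne_zero |>.mp h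
    · linarith [hlt j]
  have hb0 : 0 < ‖b‖ := norm_pos_iff.mpr (sub_ne_zero.mpr hne.symm)
  have := h a ha b r hr' (δ * ‖b‖ / (2 * (1 + ‖a‖))) (by positivity)
    fun j => by rw [hall j, abs_zero]; positivity
  have h2 : δ * ‖b‖ / (2 * (1 + ‖a‖)) * ‖a‖ < δ * ‖b‖ := by
    rw [div_mul_eq_mul_div, div_lt_iff₀ (by positivity)]
    have : 0 < δ * ‖b‖ := by positivity
    have := norm_nonneg a
    nlinarith
  linarith

/-- Every interior point of the projected dual cone is the projection of a gradient. -/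
lemma IsHyperbolic.exists_proj_gradLog_eq (hf : IsHyperbolic f p e) (hpos : 0 < fn f e) {c : ℕ}
    (M : E c →ₗ[ℝ] E d) (N : E d →ₗ[ℝ] E c) (hMN : ∀ τ σ, ⟪M τ, σ⟫ = ⟪τ, N σ⟫)
    (hne : ∃ τ, M τ ∈ hypCone f e) {s : E c}
    (hs : s ∈ interior (N '' dualCone (hypCone f e))) :
    ∃ τ, M τ ∈ hypCone f e ∧ N (gradLog f (M τ)) = s := by
  have hMc : Continuous M := M.continuous_of_finiteDimensional
  obtain ⟨ε, hε, hball⟩ := Metric.nhds_basis_closedBall.mem_iff.mp (mem_interior_iff_mem_nhds.mp hs)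
  set S : Set (E c) := M ⁻¹' closure (hypCone f e) with hS
  have hSclosed : IsClosed S := isClosed_closure.preimage hMc
  -- The ball around `s` allows a move by `ε` in the direction `-τ` inside the projected dual cone;
  -- the pairing of `τ` with the point reached is still nonnegative.
  have hcoer : ∀ τ ∈ S, ε * ‖τ‖ ≤ ⟪τ, s⟫ := by
    intro τ hτ
    rcases eq_or_ne τ 0 with rfl | h0
    · simp
    have hn : 0 < ‖τ‖ := norm_pos_iff.mpr h0
    obtain ⟨k, hk, hks⟩ := hball (a := s - (ε / ‖τ‖) • τ) (by
      rw [Metric.mem_closedBall, dist_eq_norm, sub_sub_cancel_left, norm_neg, norm_smul,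
        Real.norm_of_nonneg (by positivity), div_mul_cancel₀ _ hn.ne'])
    have h1 := inner_nonneg_of_mem_closure hτ hk
    rw [hMN, hks, inner_sub_right, inner_smul_right, real_inner_self_eq_norm_sq] at h1
    have : ε / ‖τ‖ * ‖τ‖ ^ 2 = ε * ‖τ‖ := by field_simp
    linarith
  obtain ⟨τ₁, hτ₁⟩ := hne
  -- The product is maximized instead of its logarithm, because it is continuous up to the boundary
  -- of the cone. By homogeneity it is at most a power of `‖τ‖` times `exp (-ε ‖τ‖)`.
  set g : E c → ℝ := fun τ => fn f (M τ) * Real.exp (-⟪τ, s⟫) with hg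
  have hgc : Continuous g := ((continuous_fn f).comp hMc).mul (by fun_prop)
  have hg1 : 0 < g τ₁ := mul_pos (fn_pos_of_mem hpos hτ₁) (Real.exp_pos _)
  obtain ⟨B, hB⟩ := (isCompact_closedBall (0 : E c) 1).exists_bound_of_continuousOn
    ((continuous_fn f).comp hMc).continuousOn
  have hbound : ∀ τ ∈ S, g τ ≤ B * (‖τ‖ ^ p * Real.exp (-ε * ‖τ‖)) := by
    intro τ hτ
    have hfb : fn f (M τ) ≤ B * ‖τ‖ ^ p := by
      have h1 : M τ = ‖τ‖ • M (‖τ‖⁻¹ • τ) := by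
        rw [map_smul, smul_smul]
        rcases eq_or_ne τ 0 with rfl | h0
        · simp
        · rw [mul_inv_cancel₀ (norm_ne_zero_iff.mpr h0), one_smul]
      rw [h1, fn_smul hf.homogeneous, mul_comm]
      refine mul_le_mul_of_nonneg_right ((le_abs_self _).trans (hB _ ?_)) (by positivity)
      rw [mem_closedBall_zero_iff, norm_smul, norm_inv, norm_norm]
      exact inv_mul_le_one
    have hB0 : 0 ≤ B := (norm_nonneg _).trans (hB 0 (by simp))
    rw [← mul_assoc]
    refine mul_le_mul hfb (Real.exp_le_exp.mpr ?_) (Real.exp_pos _).le (by positivity)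
    linarith [hcoer τ hτ]
  have hlim : Tendsto (fun τ : E c => B * (‖τ‖ ^ p * Real.exp (-ε * ‖τ‖))) (cocompact (E c))
      (𝓝 0) := by
    have := (tendsto_rpow_mul_exp_neg_mul_atTop_nhds_zero (p : ℝ) ε hε).comp
      (tendsto_norm_cocompact_atTop (E := E c))
    simp only [Function.comp_def, Real.rpow_natCast] at this
    simpa using this.const_mul B
  obtain ⟨τ, hτS, hmax⟩ := hgc.continuousOn.exists_isMaxOn' (s := S) hSclosed
    (x₀ := τ₁) (subset_closure hτ₁) (by
      rw [eventually_inf_principal]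
      filter_upwards [hlim.eventually (gt_mem_nhds hg1)] with τ h1 h2
      exact (hbound τ h2).trans h1.le)
  have hgτ : 0 < g τ := hg1.trans_le (hmax (subset_closure hτ₁))
  -- The maximum is positive, so `f` does not vanish there and the maximizer is not on the boundary.
  have hτC : M τ ∈ hypCone f e :=
    mem_hypCone_of_mem_closure hτS (left_ne_zero_of_mul hgτ.ne')
  refine ⟨τ, hτC, ext_inner_left ℝ fun v => ?_⟩
  have hline : Continuous fun t : ℝ => M τ + t • M v := by fun_prop
  have hd1 := hasDerivAt_log_fn_line (f := f) (M τ) (M v) (s := 0)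
    (by simpa using fn_ne_zero_of_mem hτC)
  have hd2 : HasDerivAt (fun t : ℝ => ⟪τ, s⟫ + t * ⟪v, s⟫) ⟪v, s⟫ 0 := by
    simpa using ((hasDerivAt_id (0 : ℝ)).mul_const ⟪v, s⟫).const_add ⟪τ, s⟫
  have hloc : IsLocalMax ((fun t : ℝ => Real.log (fn f (M τ + t • M v))) -
      fun t : ℝ => ⟪τ, s⟫ + t * ⟪v, s⟫) 0 := by
    have hev : ∀ᶠ t in 𝓝 (0 : ℝ), M τ + t • M v ∈ hypCone f e :=
      hline.continuousAt.eventually ((isOpen_hypCone f e).mem_nhds (by simpa using hτC))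
    filter_upwards [hev] with t ht
    have hlog : ∀ t : ℝ, M τ + t • M v ∈ hypCone f e → Real.log (g (τ + t • v)) =
        Real.log (fn f (M τ + t • M v)) - (⟪τ, s⟫ + t * ⟪v, s⟫) := by
      intro t ht
      simp only [hg]
      rw [map_add, map_smul, Real.log_mul (fn_ne_zero_of_mem ht) (Real.exp_ne_zero _), Real.log_exp,
        inner_add_left, real_inner_smul_left]
      ring
    have hmem : τ + t • v ∈ S := by
      refine subset_closure ?_
      rwa [map_add, map_smul]
    have hle : g (τ + t • v) ≤ g τ := hmax hmem
    have hp : 0 < g (τ + t • v) := by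
      simp only [hg]
      rw [map_add, map_smul]
      exact mul_pos (fn_pos_of_mem hpos ht) (Real.exp_pos _)
    have h3 := Real.log_le_log hp hle
    have h4 := hlog 0 (by simpa using hτC)
    rw [zero_smul, add_zero] at h4
    rw [hlog t ht, h4] at h3
    exact h3
  have hzero := hloc.hasDerivAt_eq_zero (hd1.sub hd2)
  rw [zero_smul, add_zero] at hzero
  rw [← hMN, real_inner_comm]
  linarith

end Gradient

/-! ### The branch of `log f` on the tube -/

/-- A continuous logarithm of a holomorphic function is holomorphic. -/
lemma differentiableAt_of_exp_eq {L g : ℂ → ℂ} {z₀ : ℂ} (hL : ContinuousAt L z₀)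
    (hg : DifferentiableAt ℂ g z₀) (h : ∀ᶠ z in 𝓝 z₀, Complex.exp (L z) = g z) :
    DifferentiableAt ℂ L z₀ := by
  have h0 : Complex.exp (L z₀) = g z₀ := h.self_of_nhds
  have hne : g z₀ ≠ 0 := h0 ▸ Complex.exp_ne_zero _
  have hd : DifferentiableAt ℂ (fun z => L z₀ + Complex.log (g z / g z₀)) z₀ := by
    refine (DifferentiableAt.clog (hg.div_const _) ?_).const_add _
    rw [div_self hne]
    exact Complex.one_mem_slitPlane
  refine hd.congr_of_eventuallyEq ?_
  -- Within distance `π` the principal logarithm inverts `exp`, so `L` agrees with the explicit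
  -- local logarithm.
  have hsmall : ∀ᶠ z in 𝓝 z₀, ‖L z - L z₀‖ < Real.pi := by
    have hc : ContinuousAt (fun z => ‖L z - L z₀‖) z₀ := (hL.sub continuousAt_const).norm
    exact hc.eventually (gt_mem_nhds (by simpa using Real.pi_pos))
  filter_upwards [h, hsmall] with z hz hs
  have him := abs_lt.mp ((Complex.abs_im_le_norm _).trans_lt hs)
  rw [← hz, ← h0, ← Complex.exp_sub, Complex.log_exp him.1 him.2.le]
  ring

section Branch

variable {d p : ℕ} {f : MvPolynomial (Fin d) ℝ} {e : E d}

lemma continuous_fnC (f : MvPolynomial (Fin d) ℝ) :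
    Continuous fun q : (E d × E d) × ℝ => fnC f q.1.1 q.1.2 q.2 := by
  have h := continuous_toC (d := d)
  simp_rw [fnC_eq_evalC]
  have h1 : Continuous fun q : (E d × E d) × ℝ => toC q.1.1 :=
    h.comp (continuous_fst.comp continuous_fst)
  have h2 : Continuous fun q : (E d × E d) × ℝ => toC q.1.2 :=
    h.comp (continuous_snd.comp continuous_fst)
  have h3 : Continuous fun q : (E d × E d) × ℝ => Complex.I * (q.2 : ℂ) :=
    continuous_const.mul (Complex.continuous_ofReal.comp continuous_snd)
  exact (continuous_evalC f).comp (h1.add (h3.smul h2))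

/-- Put `z = i s` in the factorization: `|1 - i s r|² = 1 + (s r)²` for real `r`. -/
lemma normSq_fnC {θ η : E d} {r : Fin p → ℝ}
    (hr : ∀ z : ℂ, evalC f (toC θ + z • toC η) = fn f θ * ∏ j, (1 - z * (r j : ℂ))) (s : ℝ) :
    ‖fnC f θ η s‖ ^ 2 = fn f θ ^ 2 * ∏ j, (1 + (s * r j) ^ 2) := by
  rw [fnC_eq_evalC, hr, norm_mul, mul_pow, norm_prod, ← Finset.prod_pow, Complex.norm_real,
    Real.norm_eq_abs, sq_abs]
  congr 1
  refine Finset.prod_congr rfl fun j _ => ?_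
  rw [← Complex.normSq_eq_norm_sq, Complex.normSq_apply]
  simp
  ring

lemma IsHyperbolic.fnC_ne_zero (hf : IsHyperbolic f p e) {θ : E d} (hθ : θ ∈ hypCone f e)
    (η : E d) (s : ℝ) : fnC f θ η s ≠ 0 := by
  obtain ⟨r, hr⟩ := hf.exists_factorization hθ η
  have h := normSq_fnC hr s
  have hpos : 0 < fn f θ ^ 2 * ∏ j, (1 + (s * r j) ^ 2) :=
    mul_pos (sq_pos_of_ne_zero (fn_ne_zero_of_mem hθ))
      (Finset.prod_pos fun j _ => by positivity)
  intro h0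
  rw [← h, h0, norm_zero, zero_pow two_ne_zero] at hpos
  exact lt_irrefl _ hpos

lemma one_le_prod_one_add_sq {ι : Type*} (s : Finset ι) (g : ι → ℝ) :
    1 ≤ ∏ j ∈ s, (1 + g j ^ 2) := by
  calc (1 : ℝ) = ∏ _j ∈ s, 1 := by simp
    _ ≤ _ := Finset.prod_le_prod (fun _ _ => zero_le_one) fun j _ => by nlinarith [sq_nonneg (g j)]

/-- Growth of `|f|` on the tube over the cone. -/
lemma IsHyperbolic.exists_fnC_bound (hf : IsHyperbolic f p e) (hpos : 0 < fn f e)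
    (hpt : IsPointed (hypCone f e)) :
    ∃ δ > 0, ∀ θ ∈ hypCone f e, ∀ η : E d,
      fn f θ * (δ / (1 + ‖θ‖)) * (1 + ‖η‖ ^ 2) ^ (1 / 2 : ℝ) ≤ ‖fnC f θ η 1‖ := by
  obtain ⟨δ₀, hδ₀, h₀⟩ := hf.exists_root_bound hpt
  -- The constant is shrunk below `1` to get `κ ≤ 1`, which yields `κ² (1 + ‖η‖²) ≤ 1 + (κ ‖η‖)²` at
  -- the end.
  obtain ⟨δ, hδ, hδ1, hδδ⟩ : ∃ δ > 0, δ ≤ 1 ∧ δ ≤ δ₀ :=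
    ⟨min 1 δ₀, by positivity, min_le_left _ _, min_le_right _ _⟩
  refine ⟨δ, hδ, fun θ hθ η => ?_⟩
  obtain ⟨r, hr⟩ := hf.exists_factorization hθ η
  have hfθ := fn_pos_of_mem hpos hθ
  set κ := δ / (1 + ‖θ‖) with hκ
  have hκ0 : 0 < κ := by positivity
  have hκ1 : κ ≤ 1 := by
    rw [hκ, div_le_one (by positivity)]
    linarith [norm_nonneg θ]
  have hprod : 1 + (κ * ‖η‖) ^ 2 ≤ ∏ j, (1 + (1 * r j) ^ 2) := by
    rcases eq_or_ne η 0 with rfl | hη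
    · simp only [norm_zero, mul_zero, ne_eq, OfNat.ofNat_ne_zero, not_false_eq_true, zero_pow,
        add_zero]
      exact one_le_prod_one_add_sq _ _
    have hn : 0 < ‖η‖ := norm_pos_iff.mpr hη
    -- One large root suffices, as the other factors are at least `1`. The `1 + ‖θ‖` in `κ` makes
    -- the contradiction with the root bound strict.
    obtain ⟨j, hj⟩ : ∃ j, κ * ‖η‖ ≤ |r j| := by
      by_contra! hlt
      have := h₀ θ hθ η r (fn_eq_of_factorization hr) (κ * ‖η‖) (by positivity) hlt
      have h2 : κ * ‖η‖ * ‖θ‖ < δ * ‖η‖ := by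
        rw [hκ, div_mul_eq_mul_div, div_mul_eq_mul_div, div_lt_iff₀ (by positivity)]
        have : 0 < δ * ‖η‖ := by positivity
        nlinarith [norm_nonneg θ]
      nlinarith
    have h1 : 1 + (κ * ‖η‖) ^ 2 ≤ 1 + (1 * r j) ^ 2 := by
      rw [one_mul, ← sq_abs (r j)]
      have : 0 ≤ κ * ‖η‖ := by positivity
      gcongr
    refine h1.trans ?_
    rw [← Finset.mul_prod_erase _ _ (Finset.mem_univ j)]
    refine le_mul_of_one_le_right (by positivity) ?_
    exact one_le_prod_one_add_sq _ _
  rw [← Real.sqrt_eq_rpow]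
  refine (pow_le_pow_iff_left₀ (by positivity) (norm_nonneg _) two_ne_zero).mp ?_
  rw [normSq_fnC hr, mul_pow, mul_pow, Real.sq_sqrt (by positivity), mul_assoc]
  refine mul_le_mul_of_nonneg_left (le_trans ?_ hprod) (sq_nonneg _)
  nlinarith [sq_nonneg ‖η‖]

lemma hasDerivAt_fnC (f : MvPolynomial (Fin d) ℝ) (θ η : E d) (s : ℝ) :
    HasDerivAt (fun s : ℝ => fnC f θ η s)
      (∑ j, Complex.I * (η j : ℂ) * fnC (MvPolynomial.pderiv j f) θ η s) s := by
  have h := (hasDerivAt_evalC f (toC θ) (Complex.I • toC η) (s : ℂ)).comp_ofReal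
  have heq : ∀ s : ℝ, toC θ + (s : ℂ) • Complex.I • toC η = toC θ + (Complex.I * s) • toC η :=
    fun s => by rw [smul_smul, mul_comm]
  simp_rw [heq] at h
  exact h

lemma IsHyperbolic.continuous_logBranch_integrand (hf : IsHyperbolic f p e) :
    Continuous fun q : (hypCone f e × E d) × ℝ =>
      (∑ j, Complex.I * (q.1.2 j : ℂ) * fnC (MvPolynomial.pderiv j f) q.1.1 q.1.2 q.2) /
        fnC f q.1.1 q.1.2 q.2 := by
  have hc : ∀ g : MvPolynomial (Fin d) ℝ, Continuous fun q : (hypCone f e × E d) × ℝ =>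
      fnC g (q.1.1 : E d) q.1.2 q.2 := fun g =>
    (continuous_fnC g).comp (f := fun q : (hypCone f e × E d) × ℝ =>
      (((q.1.1 : E d), q.1.2), q.2)) (by fun_prop)
  refine Continuous.div (continuous_finsetSum _ fun j _ => ?_) (hc f) fun q =>
    hf.fnC_ne_zero q.1.1.2 _ _
  exact Continuous.mul (by fun_prop) (hc _)

lemma IsHyperbolic.continuousOn_logBranch (hf : IsHyperbolic f p e) :
    ContinuousOn (fun q : E d × E d => logBranch f q.1 q.2) (hypCone f e ×ˢ univ) := by
  have h1 : Continuous fun q : hypCone f e × E d => logBranch f q.1 q.2 := by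
    unfold logBranch
    refine Continuous.add ?_
      (intervalIntegral.continuous_parametric_intervalIntegral_of_continuous'
        hf.continuous_logBranch_integrand 0 1)
    refine Complex.continuous_ofReal.comp (Continuous.log ?_ fun q => fn_ne_zero_of_mem q.1.2)
    exact (continuous_fn f).comp (by fun_prop)
  rw [continuousOn_iff_continuous_domRestrict]
  exact h1.comp (f := fun q : ↥(hypCone f e ×ˢ (univ : Set (E d))) =>
    ((⟨q.1.1, q.2.1⟩ : hypCone f e), q.1.2)) (by fun_prop)

/-- With `Φ u` the continuation up to `θ + i u η`, the function `exp (-Φ u) * f (θ + i u η)` has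
zero derivative and equals `1` at `u = 0`. -/
lemma IsHyperbolic.exp_logBranch (hf : IsHyperbolic f p e) (hpos : 0 < fn f e) {θ : E d}
    (hθ : θ ∈ hypCone f e) (η : E d) : Complex.exp (logBranch f θ η) = fnC f θ η 1 := by
  set F : ℝ → ℂ := fun s => (∑ j, Complex.I * (η j : ℂ) * fnC (MvPolynomial.pderiv j f) θ η s) /
    fnC f θ η s with hF
  have hFc : Continuous F := hf.continuous_logBranch_integrand.comp
    (f := fun s : ℝ => (((⟨θ, hθ⟩ : hypCone f e), η), s)) (by fun_prop)
  set Φ : ℝ → ℂ := fun u => (Real.log (fn f θ) : ℂ) + ∫ s in (0 : ℝ)..u, F s with hΦ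
  have hΦd : ∀ u, HasDerivAt Φ (F u) u := fun u =>
    (intervalIntegral.integral_hasDerivAt_right (hFc.intervalIntegrable _ _)
      (hFc.stronglyMeasurableAtFilter _ _) hFc.continuousAt).const_add _
  have hd : ∀ u, HasDerivAt (fun u => Complex.exp (-Φ u) * fnC f θ η u) 0 u := by
    intro u
    refine ((hΦd u).neg.cexp.mul (hasDerivAt_fnC f θ η u)).congr_deriv ?_
    have hmul : F u * fnC f θ η u =
        ∑ j, Complex.I * (η j : ℂ) * fnC (MvPolynomial.pderiv j f) θ η u :=
      div_mul_cancel₀ _ (hf.fnC_ne_zero hθ η u)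
    rw [← hmul, Pi.neg_apply]
    ring
  have hconst := is_const_of_deriv_eq_zero (fun u => (hd u).differentiableAt)
    (fun u => (hd u).deriv) 1 0
  have h0 : fnC f θ η 0 = fn f θ := by
    rw [fnC_eq_evalC]
    simp [evalC_toC]
  have hΦ0 : Φ 0 = (Real.log (fn f θ) : ℂ) := by simp [hΦ]
  have hfθ := fn_pos_of_mem hpos hθ
  rw [h0, hΦ0, ← Complex.ofReal_neg, ← Complex.ofReal_exp, ← Complex.ofReal_mul,
    Real.exp_neg, Real.exp_log hfθ, inv_mul_cancel₀ hfθ.ne', Complex.ofReal_one] at hconst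
  have h1 : logBranch f θ η = Φ 1 := rfl
  rw [h1]
  have h2 : Complex.exp (Φ 1) * (Complex.exp (-Φ 1) * fnC f θ η 1) = fnC f θ η 1 := by
    rw [← mul_assoc, ← Complex.exp_add, add_neg_cancel, Complex.exp_zero, one_mul]
  rw [← h2, hconst, mul_one]

lemma logBranch_zero (f : MvPolynomial (Fin d) ℝ) (θ : E d) :
    logBranch f θ 0 = (Real.log (fn f θ) : ℂ) := by
  simp [logBranch]

/-- The power `f (θ + i η) ^ (-α)` decays like `‖η‖ ^ (-α)`. -/
lemma IsHyperbolic.exists_norm_power_le (hf : IsHyperbolic f p e) (hpos : 0 < fn f e)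
    (hpt : IsPointed (hypCone f e)) {α : ℝ} (hα : 0 < α) :
    ∃ δ > 0, ∀ θ ∈ hypCone f e, ∀ η : E d,
      ‖Complex.exp (-(α : ℂ) * logBranch f θ η)‖ ≤
        (fn f θ * (δ / (1 + ‖θ‖))) ^ (-α) * (1 + ‖η‖ ^ 2) ^ (-α / 2) := by
  obtain ⟨δ, hδ, h⟩ := hf.exists_fnC_bound hpos hpt
  refine ⟨δ, hδ, fun θ hθ η => ?_⟩
  have hfθ := fn_pos_of_mem hpos hθ
  have h1 : ‖Complex.exp (-(α : ℂ) * logBranch f θ η)‖ = ‖fnC f θ η 1‖ ^ (-α) := by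
    rw [← hf.exp_logBranch hpos hθ, Complex.norm_exp, Complex.norm_exp, ← Real.exp_mul]
    simp [mul_comm]
  have hb : 0 < fn f θ * (δ / (1 + ‖θ‖)) := by positivity
  have hw : (0 : ℝ) < 1 + ‖η‖ ^ 2 := by positivity
  have h2 : (1 + ‖η‖ ^ 2) ^ (-α / 2) = ((1 + ‖η‖ ^ 2) ^ (1 / 2 : ℝ)) ^ (-α) := by
    rw [← Real.rpow_mul hw.le]
    congr 1
    ring
  rw [h1, h2, ← Real.mul_rpow hb.le (by positivity)]
  exact Real.rpow_le_rpow_of_nonpos (by positivity) (h θ hθ η) (by linarith)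

end Branch

/-! ### The Riesz kernel -/

section Riesz

variable {d p : ℕ} {f : MvPolynomial (Fin d) ℝ} {e : E d} {α : ℝ}

/-- The complex integral whose real part, divided by `(2π)^d`, is the Riesz kernel. -/
def rieszIntegral (f : MvPolynomial (Fin d) ℝ) (α : ℝ) (θ σ : E d) : ℂ :=
  ∫ η : E d, rieszIntegrand f α θ σ η

lemma IsHyperbolic.continuousOn_rieszIntegrand (hf : IsHyperbolic f p e) (α : ℝ) (σ : E d) :
    ContinuousOn (fun q : E d × E d => rieszIntegrand f α q.1 σ q.2) (hypCone f e ×ˢ univ) := by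
  unfold rieszIntegrand
  refine ((continuousOn_const.mul hf.continuousOn_logBranch).cexp).mul
    (Continuous.continuousOn ?_)
  fun_prop

lemma IsHyperbolic.continuous_rieszIntegrand (hf : IsHyperbolic f p e) (α : ℝ) {θ : E d}
    (hθ : θ ∈ hypCone f e) (σ : E d) : Continuous (rieszIntegrand f α θ σ) :=
  (hf.continuousOn_rieszIntegrand α σ).comp_continuous (f := fun η => (θ, η)) (by fun_prop)
    fun _ => ⟨hθ, mem_univ _⟩

lemma norm_rieszIntegrand (f : MvPolynomial (Fin d) ℝ) (α : ℝ) (θ σ η : E d) :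
    ‖rieszIntegrand f α θ σ η‖ =
      ‖Complex.exp (-(α : ℂ) * logBranch f θ η)‖ * Real.exp ⟪θ, σ⟫ := by
  rw [rieszIntegrand, norm_mul, Complex.norm_exp (_ + _)]
  simp

lemma integrable_weight (hα : (d : ℝ) < α) :
    Integrable fun η : E d => (1 + ‖η‖ ^ 2) ^ (-α / 2) :=
  integrable_rpow_neg_one_add_norm_sq (by simpa using hα)

/-- The constant in the bound for the Riesz integrand. -/
def rieszBound (f : MvPolynomial (Fin d) ℝ) (α δ : ℝ) (σ θ : E d) : ℝ :=
  (fn f θ * (δ / (1 + ‖θ‖))) ^ (-α) * Real.exp ⟪θ, σ⟫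

lemma norm_rieszIntegrand_le {δ : ℝ} {θ η : E d}
    (h : ‖Complex.exp (-(α : ℂ) * logBranch f θ η)‖ ≤
        (fn f θ * (δ / (1 + ‖θ‖))) ^ (-α) * (1 + ‖η‖ ^ 2) ^ (-α / 2)) (σ : E d) :
    ‖rieszIntegrand f α θ σ η‖ ≤ rieszBound f α δ σ θ * (1 + ‖η‖ ^ 2) ^ (-α / 2) := by
  rw [norm_rieszIntegrand, rieszBound, mul_right_comm]
  exact mul_le_mul_of_nonneg_right h (Real.exp_pos _).le

lemma IsHyperbolic.integrable_rieszIntegrand (hf : IsHyperbolic f p e) (hpos : 0 < fn f e)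
    (hpt : IsPointed (hypCone f e)) (hα : (d : ℝ) < α) {θ : E d} (hθ : θ ∈ hypCone f e)
    (σ : E d) : Integrable (rieszIntegrand f α θ σ) := by
  obtain ⟨δ, -, h⟩ := hf.exists_norm_power_le hpos hpt ((Nat.cast_nonneg d).trans_lt hα)
  exact ((integrable_weight hα).const_mul _).mono'
    (hf.continuous_rieszIntegrand α hθ σ).aestronglyMeasurable
    (ae_of_all _ fun η => norm_rieszIntegrand_le (h θ hθ η) σ)

lemma IsHyperbolic.norm_rieszIntegral_le (hf : IsHyperbolic f p e) (hpos : 0 < fn f e)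
    (hpt : IsPointed (hypCone f e)) (hα : (d : ℝ) < α) :
    ∃ δ > 0, ∀ θ ∈ hypCone f e, ∀ σ : E d, ‖rieszIntegral f α θ σ‖ ≤
      rieszBound f α δ σ θ * ∫ η : E d, (1 + ‖η‖ ^ 2) ^ (-α / 2) := by
  obtain ⟨δ, hδ, h⟩ := hf.exists_norm_power_le hpos hpt ((Nat.cast_nonneg d).trans_lt hα)
  refine ⟨δ, hδ, fun θ hθ σ => ?_⟩
  rw [← integral_const_mul]
  exact norm_integral_le_of_norm_le ((integrable_weight hα).const_mul _)
    (ae_of_all _ fun η => norm_rieszIntegrand_le (h θ hθ η) σ)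

/-- The branch need not be differentiated under its integral: it is continuous and exponentiates to
a polynomial along the complex line, hence is holomorphic there. -/
lemma IsHyperbolic.differentiableOn_rieszIntegrand (hf : IsHyperbolic f p e) (hpos : 0 < fn f e)
    (α : ℝ) (θ v σ η : E d) :
    DifferentiableOn ℂ (fun z : ℂ => rieszIntegrand f α (θ + z.re • v) σ (η + z.im • v))
      {z | θ + z.re • v ∈ hypCone f e} := by
  have hlc : Continuous fun z : ℂ => θ + z.re • v := by fun_prop
  have hopen : IsOpen {z : ℂ | θ + z.re • v ∈ hypCone f e} := (isOpen_hypCone f e).preimage hlc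
  intro z₀ hz₀
  refine DifferentiableAt.differentiableWithinAt ?_
  have hL : DifferentiableAt ℂ (fun z : ℂ => logBranch f (θ + z.re • v) (η + z.im • v)) z₀ := by
    refine differentiableAt_of_exp_eq (g := fun z =>
      evalC f ((toC θ + Complex.I • toC η) + z • toC v)) ?_
      (hasDerivAt_evalC f _ _ z₀).differentiableAt ?_
    · have hc : ContinuousAt (fun z : ℂ => (θ + z.re • v, η + z.im • v)) z₀ := by fun_prop
      exact ContinuousAt.comp (f := fun z : ℂ => (θ + z.re • v, η + z.im • v))
        (hf.continuousOn_logBranch.continuousAt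
          (((isOpen_hypCone f e).prod isOpen_univ).mem_nhds ⟨hz₀, mem_univ _⟩)) hc
    · filter_upwards [hopen.mem_nhds hz₀] with z hz
      rw [hf.exp_logBranch hpos hz, fnC_eq_evalC]
      congr 1
      conv_rhs => rw [← Complex.re_add_im z]
      simp only [toC_add, toC_smul, Complex.ofReal_one, one_mul, smul_add, add_smul, smul_smul,
        mul_comm Complex.I]
      abel
  have hE : (fun z : ℂ => Complex.exp ((⟪θ + z.re • v, σ⟫ : ℂ) +
      Complex.I * (⟪η + z.im • v, σ⟫ : ℂ))) = fun z : ℂ => Complex.exp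
        ((⟪θ, σ⟫ : ℂ) + Complex.I * (⟪η, σ⟫ : ℂ) + z * (⟪v, σ⟫ : ℂ)) := by
    ext z
    congr 1
    conv_rhs => rw [← Complex.re_add_im z]
    rw [inner_add_left, inner_add_left, real_inner_smul_left, real_inner_smul_left]
    push_cast
    ring
  have hE' : DifferentiableAt ℂ (fun z : ℂ => Complex.exp ((⟪θ + z.re • v, σ⟫ : ℂ) +
      Complex.I * (⟪η + z.im • v, σ⟫ : ℂ))) z₀ := by
    rw [hE]
    fun_prop
  unfold rieszIntegrand
  exact (hL.const_mul _).cexp.mul hE'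

/-- Cauchy's theorem on a rectangle of height `R` in the tube. -/
lemma IsHyperbolic.norm_segment_integral_sub_le (hf : IsHyperbolic f p e) (hpos : 0 < fn f e)
    (α : ℝ) {θ θ' : E d} (hθ : θ ∈ hypCone f e) (hθ' : θ' ∈ hypCone f e) (σ η : E d) (R : ℝ)
    {B₀ B₁ : ℝ} (h₀ : ∀ x ∈ Icc (0 : ℝ) 1, ‖rieszIntegrand f α (θ + x • (θ' - θ)) σ η‖ ≤ B₀)
    (h₁ : ∀ x ∈ Icc (0 : ℝ) 1,
      ‖rieszIntegrand f α (θ + x • (θ' - θ)) σ (η + R • (θ' - θ))‖ ≤ B₁) :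
    ‖(∫ y in (0 : ℝ)..R, rieszIntegrand f α θ' σ (η + y • (θ' - θ))) -
      ∫ y in (0 : ℝ)..R, rieszIntegrand f α θ σ (η + y • (θ' - θ))‖ ≤ B₀ + B₁ := by
  set v := θ' - θ with hv
  have hmem : ∀ x ∈ Icc (0 : ℝ) 1, θ + x • v ∈ hypCone f e := fun x hx =>
    hf.convex_hypCone.add_smul_sub_mem hθ hθ' hx
  have hrect := Complex.integral_boundary_rect_eq_zero_of_differentiableOn
    (fun z : ℂ => rieszIntegrand f α (θ + z.re • v) σ (η + z.im • v)) 0 ⟨1, R⟩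
    ((hf.differentiableOn_rieszIntegrand hpos α θ v σ η).mono fun z hz => by
      refine hmem _ ?_
      have := hz.1
      simpa using this)
  have h1v : θ + v = θ' := by rw [hv]; abel
  simp only [Complex.zero_re, Complex.zero_im, Complex.add_re, Complex.add_im, Complex.ofReal_re,
    Complex.ofReal_im, Complex.mul_re, Complex.mul_im, Complex.I_re, Complex.I_im, mul_zero,
    mul_one, zero_mul, add_zero, zero_add, Complex.ofReal_zero, Complex.ofReal_one, Complex.one_re,
    Complex.one_im, one_smul, zero_smul, h1v, smul_eq_mul, sub_self] at hrect
  have hb : ∀ {g : ℝ → ℂ} {B : ℝ}, (∀ x ∈ Icc (0 : ℝ) 1, ‖g x‖ ≤ B) →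
      ‖∫ x in (0 : ℝ)..1, g x‖ ≤ B := by
    intro g B hg
    have := intervalIntegral.norm_integral_le_of_norm_le_const (a := 0) (b := 1) (f := g) (C := B)
      fun x hx => hg x (by
        rw [uIoc_of_le zero_le_one] at hx
        exact ⟨hx.1.le, hx.2⟩)
    simpa using this
  have hb0 := hb h₀
  have hb1 := hb h₁
  set A₀ := ∫ x in (0 : ℝ)..1, rieszIntegrand f α (θ + x • v) σ η
  set A₁ := ∫ x in (0 : ℝ)..1, rieszIntegrand f α (θ + x • v) σ (η + R • v)
  set D₁ := ∫ y in (0 : ℝ)..R, rieszIntegrand f α θ' σ (η + y • v)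
  set D₀ := ∫ y in (0 : ℝ)..R, rieszIntegrand f α θ σ (η + y • v)
  have hID : Complex.I * (D₁ - D₀) = A₁ - A₀ := by
    linear_combination hrect
  have : ‖D₁ - D₀‖ = ‖A₁ - A₀‖ := by
    rw [← hID, norm_mul, Complex.norm_I, one_mul]
  rw [this]
  exact (norm_sub_le _ _).trans (by linarith)

/-- The Riesz integral does not depend on the base point. -/
lemma IsHyperbolic.rieszIntegral_eq (hf : IsHyperbolic f p e) (hpos : 0 < fn f e)
    (hpt : IsPointed (hypCone f e)) (hα : (d : ℝ) < α) {θ θ' : E d} (hθ : θ ∈ hypCone f e)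
    (hθ' : θ' ∈ hypCone f e) (σ : E d) : rieszIntegral f α θ' σ = rieszIntegral f α θ σ := by
  set v := θ' - θ with hv
  set w : E d → ℝ := fun η => (1 + ‖η‖ ^ 2) ^ (-α / 2) with hw
  have hwint : Integrable w := integrable_weight hα
  have hmem : ∀ x ∈ Icc (0 : ℝ) 1, θ + x • v ∈ hypCone f e := fun x hx =>
    hf.convex_hypCone.add_smul_sub_mem hθ hθ' hx
  obtain ⟨B, hB⟩ : ∃ B, ∀ x ∈ Icc (0 : ℝ) 1, ∀ η,
      ‖rieszIntegrand f α (θ + x • v) σ η‖ ≤ B * w η := by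
    obtain ⟨δ, hδ, h⟩ := hf.exists_norm_power_le hpos hpt ((Nat.cast_nonneg d).trans_lt hα)
    have hc : ContinuousOn (fun x : ℝ => rieszBound f α δ σ (θ + x • v)) (Icc 0 1) := by
      unfold rieszBound
      refine ContinuousOn.mul (ContinuousOn.rpow_const ?_ fun x hx => Or.inl ?_)
        (Continuous.continuousOn (by fun_prop))
      · refine (((continuous_fn f).comp (by fun_prop)).mul
          (continuous_const.div (by fun_prop) fun x => ?_)).continuousOn
        positivity
      · have := fn_pos_of_mem hpos (hmem x hx)
        positivity
    obtain ⟨B, hB⟩ := isCompact_Icc.exists_bound_of_continuousOn hc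
    refine ⟨B, fun x hx η => (norm_rieszIntegrand_le (h _ (hmem x hx) η) σ).trans ?_⟩
    exact mul_le_mul_of_nonneg_right ((le_abs_self _).trans (hB x hx)) (by positivity)
  have hswap : ∀ {ϑ : E d}, ϑ ∈ hypCone f e → ∀ R : ℝ,
      Integrable (Function.uncurry fun (y : ℝ) η => rieszIntegrand f α ϑ σ (η + y • v))
        ((volume.restrict (uIoc 0 R)).prod volume) := by
    intro ϑ hϑ R
    have hint := hf.integrable_rieszIntegrand hpos hpt hα hϑ σ
    have hcont := hf.continuous_rieszIntegrand α hϑ σ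
    have hm : AEStronglyMeasurable
        (Function.uncurry fun (y : ℝ) η => rieszIntegrand f α ϑ σ (η + y • v))
        ((volume.restrict (uIoc 0 R)).prod volume) :=
      Continuous.aestronglyMeasurable (hcont.comp
        (f := fun q : ℝ × E d => q.2 + q.1 • v) (by fun_prop))
    rw [integrable_prod_iff hm]
    refine ⟨ae_of_all _ fun y => hint.comp_add_right (y • v), ?_⟩
    simp only [Function.uncurry]
    have : ∀ y : ℝ, ∫ η, ‖rieszIntegrand f α ϑ σ (η + y • v)‖ =
        ∫ η, ‖rieszIntegrand f α ϑ σ η‖ := fun y =>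
      integral_add_right_eq_self (fun η => ‖rieszIntegrand f α ϑ σ η‖) (y • v)
    simp_rw [this]
    have hfin : IsFiniteMeasure (volume.restrict (uIoc 0 R)) := by
      rw [uIoc]
      infer_instance
    exact integrable_const _
  -- Integrated over all `η`, a vertical side of the rectangle becomes `R` copies of the Riesz
  -- integral, by Fubini and translation invariance.
  have hav : ∀ {ϑ : E d}, ϑ ∈ hypCone f e → ∀ R : ℝ,
      ∫ η, (∫ y in (0 : ℝ)..R, rieszIntegrand f α ϑ σ (η + y • v)) =
        R * rieszIntegral f α ϑ σ := by
    intro ϑ hϑ R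
    rw [← intervalIntegral_integral_swap (hswap hϑ R)]
    have : ∀ y : ℝ, ∫ η, rieszIntegrand f α ϑ σ (η + y • v) = rieszIntegral f α ϑ σ := fun y =>
      integral_add_right_eq_self (rieszIntegrand f α ϑ σ) (y • v)
    simp_rw [this]
    simp
  have havi : ∀ {ϑ : E d}, ϑ ∈ hypCone f e → ∀ R : ℝ, 0 ≤ R →
      Integrable fun η => ∫ y in (0 : ℝ)..R, rieszIntegrand f α ϑ σ (η + y • v) := by
    intro ϑ hϑ R hR
    have := (hswap hϑ R).integral_prod_right
    simp_rw [intervalIntegral.integral_of_le hR]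
    rw [uIoc_of_le hR] at this
    exact this
  -- The horizontal sides contribute a total independent of `R`, so letting `R` grow forces the two
  -- Riesz integrals to agree.
  have hkey : ∀ R : ℝ, 0 < R →
      R * ‖rieszIntegral f α θ' σ - rieszIntegral f α θ σ‖ ≤ 2 * (B * ∫ η, w η) := by
    intro R hR
    have h1 : R * ‖rieszIntegral f α θ' σ - rieszIntegral f α θ σ‖ =
        ‖∫ η, ((∫ y in (0 : ℝ)..R, rieszIntegrand f α θ' σ (η + y • v)) -
          ∫ y in (0 : ℝ)..R, rieszIntegrand f α θ σ (η + y • v))‖ := by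
      rw [integral_sub (havi hθ' R hR.le) (havi hθ R hR.le), hav hθ', hav hθ, ← mul_sub, norm_mul,
        Complex.norm_real, Real.norm_of_nonneg hR.le]
    have h2 : 2 * (B * ∫ η, w η) = ∫ η, (B * w η + B * w (η + R • v)) := by
      rw [integral_add (hwint.const_mul _) ((hwint.comp_add_right _).const_mul _),
        integral_const_mul, integral_const_mul, integral_add_right_eq_self w]
      ring
    rw [h1, h2]
    refine norm_integral_le_of_norm_le
      ((hwint.const_mul _).add ((hwint.comp_add_right _).const_mul _)) (ae_of_all _ fun η => ?_)
    exact hf.norm_segment_integral_sub_le hpos α hθ hθ' σ η R (fun x hx => hB x hx η)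
      fun x hx => hB x hx _
  by_contra hne
  have hn : 0 < ‖rieszIntegral f α θ' σ - rieszIntegral f α θ σ‖ :=
    norm_pos_iff.mpr (sub_ne_zero.mpr hne)
  set I := 2 * (B * ∫ η, w η) with hI
  have := hkey ((|I| + 1) / ‖rieszIntegral f α θ' σ - rieszIntegral f α θ σ‖) (by positivity)
  rw [div_mul_cancel₀ _ hn.ne'] at this
  linarith [le_abs_self I]

end Riesz

/-! ### The Riesz kernel represents `f ^ (-α)` -/

/-- Since `C` is open, `θ - (ε / ‖σ‖) σ` still lies in it; pair this point with `σ`. This gives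
exponential decay of `exp (-⟪θ, σ⟫)` on the dual cone. -/
lemma exists_mul_norm_le_inner {d : ℕ} {C : Set (E d)} (hC : IsOpen C) {θ : E d} (hθ : θ ∈ C) :
    ∃ ε > 0, ∀ σ ∈ dualCone C, ε * ‖σ‖ ≤ ⟪θ, σ⟫ := by
  obtain ⟨ε, hε, hball⟩ := Metric.nhds_basis_closedBall.mem_iff.mp (hC.mem_nhds hθ)
  refine ⟨ε, hε, fun σ hσ => ?_⟩
  rcases eq_or_ne σ 0 with rfl | h0
  · simp
  have hn : 0 < ‖σ‖ := norm_pos_iff.mpr h0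
  have hmem : θ - (ε / ‖σ‖) • σ ∈ C := hball (by
    rw [Metric.mem_closedBall, dist_eq_norm, sub_sub_cancel_left, norm_neg, norm_smul,
      Real.norm_of_nonneg (by positivity), div_mul_cancel₀ _ hn.ne'])
  have h1 := mem_dualCone.mp hσ _ hmem
  rw [inner_sub_left, real_inner_smul_left, real_inner_self_eq_norm_sq] at h1
  have : ε / ‖σ‖ * ‖σ‖ ^ 2 = ε * ‖σ‖ := by field_simp
  linarith

/-- Comparison with `(1 + ‖σ‖)^(-(d+1))` through `x^(d+1) / (d+1)! ≤ exp x`. -/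
lemma integrable_exp_neg_mul_norm (d : ℕ) {ε : ℝ} (hε : 0 < ε) :
    Integrable fun σ : E d => Real.exp (-(ε * ‖σ‖)) := by
  have hint : Integrable fun σ : E d => (1 + ‖σ‖) ^ (-((d + 1 : ℕ) : ℝ)) :=
    integrable_one_add_norm (by simp)
  refine (hint.const_mul (Real.exp ε * ((d + 1).factorial / ε ^ (d + 1)))).mono'
    (Continuous.aestronglyMeasurable (by fun_prop)) (ae_of_all _ fun σ => ?_)
  have h1 : (0 : ℝ) < 1 + ‖σ‖ := by positivity
  have h := Real.pow_div_factorial_le_exp (x := ε * (1 + ‖σ‖)) (by positivity) (d + 1)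
  rw [Real.norm_of_nonneg (Real.exp_pos _).le, Real.rpow_neg h1.le, Real.rpow_natCast, Real.exp_neg]
  have h2 : Real.exp (ε * (1 + ‖σ‖)) = Real.exp ε * Real.exp (ε * ‖σ‖) := by
    rw [← Real.exp_add]
    ring_nf
  rw [h2, mul_pow] at h
  have hfac : (0 : ℝ) < (d + 1).factorial := by positivity
  rw [div_le_iff₀ hfac] at h
  have h3 : Real.exp ε * ((d + 1).factorial / ε ^ (d + 1)) * ((1 + ‖σ‖) ^ (d + 1))⁻¹ =
      (Real.exp ε * (d + 1).factorial) / (ε ^ (d + 1) * (1 + ‖σ‖) ^ (d + 1)) := by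
    field_simp
  rw [h3, le_div_iff₀ (by positivity), inv_mul_le_iff₀ (Real.exp_pos _)]
  linarith

section Inversion

variable {d p : ℕ} {f : MvPolynomial (Fin d) ℝ} {e : E d} {α : ℝ}

/-- The Riesz kernel is supported on the dual cone. -/
lemma IsHyperbolic.rieszIntegral_eq_zero (hf : IsHyperbolic f p e) (hpos : 0 < fn f e)
    (hpt : IsPointed (hypCone f e)) (hα : (d : ℝ) < α) {θ₀ : E d} (hθ₀ : θ₀ ∈ hypCone f e)
    {σ : E d} (hσ : σ ∉ dualCone (hypCone f e)) : rieszIntegral f α θ₀ σ = 0 := by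
  have hα0 : 0 < α := (Nat.cast_nonneg d).trans_lt hα
  rw [mem_dualCone] at hσ
  push Not at hσ
  obtain ⟨θ, hθ, hneg⟩ := hσ
  obtain ⟨δ, hδ, h⟩ := hf.norm_rieszIntegral_le hpos hpt hα
  set W := ∫ η : E d, (1 + ‖η‖ ^ 2) ^ (-α / 2) with hW
  have hW0 : 0 ≤ W := integral_nonneg fun η => by positivity
  have hfθ := fn_pos_of_mem hpos hθ
  set m := fn f θ * (δ / (1 + ‖θ‖)) with hm
  have hm0 : 0 < m := by positivity
  -- The base point is moved to `s θ`, where `⟪θ, σ⟫ < 0`. The factor `exp (s ⟪θ, σ⟫)` then beats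
  -- the growth `s ^ α` as `s` tends to infinity.
  have hbound : ∀ s : ℝ, 1 ≤ s → ‖rieszIntegral f α θ₀ σ‖ ≤
      m ^ (-α) * W * (s ^ α * Real.exp (-(-⟪θ, σ⟫) * s)) := by
    intro s hs
    have hs0 : 0 < s := by linarith
    have hsθ := hf.smul_mem hθ hs0
    rw [hf.rieszIntegral_eq hpos hpt hα hsθ hθ₀]
    refine (h _ hsθ σ).trans ?_
    have hb : m * s⁻¹ ≤ fn f (s • θ) * (δ / (1 + ‖s • θ‖)) := by
      rw [hm, mul_assoc, fn_smul hf.homogeneous, norm_smul, Real.norm_of_nonneg hs0.le]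
      refine mul_le_mul (le_mul_of_one_le_left hfθ.le (one_le_pow₀ hs)) ?_ (by positivity)
        (by positivity)
      rw [div_mul_eq_mul_div, div_le_div_iff₀ (by positivity) (by positivity), mul_assoc]
      refine mul_le_mul_of_nonneg_left ?_ hδ.le
      rw [inv_mul_le_iff₀ hs0]
      linarith
    have hb2 : (fn f (s • θ) * (δ / (1 + ‖s • θ‖))) ^ (-α) ≤ m ^ (-α) * s ^ α := by
      refine (Real.rpow_le_rpow_of_nonpos (by positivity) hb (by linarith)).trans (le_of_eq ?_)
      rw [Real.mul_rpow hm0.le (by positivity), Real.inv_rpow hs0.le, Real.rpow_neg hs0.le, inv_inv]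
    have hexp : Real.exp ⟪s • θ, σ⟫ = Real.exp (-(-⟪θ, σ⟫) * s) := by
      rw [real_inner_smul_left, neg_neg, mul_comm]
    rw [rieszBound, hexp]
    calc _ ≤ m ^ (-α) * s ^ α * Real.exp (-(-⟪θ, σ⟫) * s) * W := by gcongr
      _ = _ := by ring
  have hlim := (tendsto_rpow_mul_exp_neg_mul_atTop_nhds_zero α (-⟪θ, σ⟫) (by linarith)).const_mul
    (m ^ (-α) * W)
  rw [mul_zero] at hlim
  have := ge_of_tendsto hlim ((eventually_ge_atTop 1).mono hbound)
  exact norm_le_zero_iff.mp this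

/-- With the same `θ` in both factors the real exponentials cancel, leaving a Fourier integral of `f
(θ + i η)^(-α)`. -/
lemma exp_neg_mul_rieszIntegral (f : MvPolynomial (Fin d) ℝ) (α : ℝ) (θ σ : E d) :
    (Real.exp (-⟪θ, σ⟫) : ℂ) * rieszIntegral f α θ σ =
      ∫ η : E d, Complex.exp (-(α : ℂ) * logBranch f θ η) *
        Complex.exp (Complex.I * (⟪η, σ⟫ : ℂ)) := by
  rw [rieszIntegral, ← integral_const_mul]
  refine integral_congr_ae (ae_of_all _ fun η => ?_)
  simp only [rieszIntegrand, Complex.ofReal_exp]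
  rw [← Complex.exp_add, ← Complex.exp_add, ← Complex.exp_add]
  congr 1
  push_cast
  ring

lemma rieszIntegrand_zero (f : MvPolynomial (Fin d) ℝ) (α : ℝ) (θ η : E d) :
    rieszIntegrand f α θ 0 η = Complex.exp (-(α : ℂ) * logBranch f θ η) := by
  simp [rieszIntegrand]

/-- Moving the base point to `θ / 2` bounds the Riesz integral by a multiple of `exp (⟪θ, σ⟫ / 2)`;
half of the decay is left over on the dual cone, and off it the integral vanishes. -/
lemma IsHyperbolic.integrable_exp_neg_mul_rieszIntegral (hf : IsHyperbolic f p e)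
    (hpos : 0 < fn f e) (hpt : IsPointed (hypCone f e)) (hα : (d : ℝ) < α) {θ : E d}
    (hθ : θ ∈ hypCone f e) :
    Integrable fun σ : E d => (Real.exp (-⟪θ, σ⟫) : ℂ) * rieszIntegral f α θ σ := by
  have hGint := hf.integrable_rieszIntegrand hpos hpt hα hθ 0
  have hGcont := hf.continuous_rieszIntegrand α hθ 0
  simp_rw [funext (rieszIntegrand_zero f α θ)] at hGint hGcont
  have hcont : Continuous fun σ : E d => (Real.exp (-⟪θ, σ⟫) : ℂ) * rieszIntegral f α θ σ := by
    simp_rw [exp_neg_mul_rieszIntegral]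
    refine continuous_of_dominated (bound := fun η =>
      ‖Complex.exp (-(α : ℂ) * logBranch f θ η)‖) (fun σ => ?_) (fun σ => ae_of_all _ fun η => ?_)
      hGint.norm (ae_of_all _ fun η => by fun_prop)
    · exact (hGcont.mul (by fun_prop)).aestronglyMeasurable
    · rw [norm_mul, mul_comm Complex.I, Complex.norm_exp_ofReal_mul_I, mul_one]
  obtain ⟨δ, hδ, h⟩ := hf.norm_rieszIntegral_le hpos hpt hα
  obtain ⟨ε, hε, hεK⟩ := exists_mul_norm_le_inner (isOpen_hypCone f e) hθ
  set W := ∫ η : E d, (1 + ‖η‖ ^ 2) ^ (-α / 2) with hW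
  have hW0 : 0 ≤ W := integral_nonneg fun η => by positivity
  set θ' : E d := (1 / 2 : ℝ) • θ with hθ'
  have hθ'C : θ' ∈ hypCone f e := hf.smul_mem hθ (by norm_num)
  set m := (fn f θ' * (δ / (1 + ‖θ'‖))) ^ (-α) with hm
  have hm0 : 0 ≤ m := by
    have := fn_pos_of_mem hpos hθ'C
    positivity
  refine ((integrable_exp_neg_mul_norm d (ε := ε / 2) (by positivity)).const_mul (m * W)).mono'
    hcont.aestronglyMeasurable (ae_of_all _ fun σ => ?_)
  by_cases hσ : σ ∈ dualCone (hypCone f e)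
  · rw [hf.rieszIntegral_eq hpos hpt hα hθ'C hθ, norm_mul, Complex.norm_real,
      Real.norm_of_nonneg (Real.exp_pos _).le]
    have h1 := h θ' hθ'C σ
    rw [rieszBound] at h1
    calc Real.exp (-⟪θ, σ⟫) * ‖rieszIntegral f α θ' σ‖
        ≤ Real.exp (-⟪θ, σ⟫) * (m * Real.exp ⟪θ', σ⟫ * W) := by gcongr
      _ = m * W * Real.exp (-(⟪θ, σ⟫ / 2)) := by
        have : Real.exp (-⟪θ, σ⟫) * Real.exp ⟪θ', σ⟫ = Real.exp (-(⟪θ, σ⟫ / 2)) := by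
          rw [← Real.exp_add, hθ', real_inner_smul_left]
          ring_nf
        rw [← this]
        ring
      _ ≤ m * W * Real.exp (-(ε / 2 * ‖σ‖)) := by
        have := hεK σ hσ
        gcongr
        linarith
  · rw [hf.rieszIntegral_eq_zero hpos hpt hα hθ hσ, mul_zero, norm_zero]
    positivity

-- Fourier inversion at the origin for `G η = f (θ + i η)^(-α)`. The factor `(2π)^d` comes from
-- rescaling by `-2π`, as `𝓕` uses the kernel `exp (-2π i ⟪η, w⟫)`.
open FourierTransform in
lemma IsHyperbolic.integral_exp_neg_mul_rieszIntegral (hf : IsHyperbolic f p e)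
    (hpos : 0 < fn f e) (hpt : IsPointed (hypCone f e)) (hα : (d : ℝ) < α) {θ : E d}
    (hθ : θ ∈ hypCone f e) :
    ∫ σ : E d, (Real.exp (-⟪θ, σ⟫) : ℂ) * rieszIntegral f α θ σ =
      (((2 * Real.pi) ^ d * fn f θ ^ (-α) : ℝ) : ℂ) := by
  have hGint := hf.integrable_rieszIntegrand hpos hpt hα hθ 0
  have hGcont := hf.continuous_rieszIntegrand α hθ 0
  simp_rw [funext (rieszIntegrand_zero f α θ)] at hGint hGcont
  set G : E d → ℂ := fun η => Complex.exp (-(α : ℂ) * logBranch f θ η) with hG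
  set φ : E d → ℂ := fun σ => (Real.exp (-⟪θ, σ⟫) : ℂ) * rieszIntegral f α θ σ with hφ
  have hφint : Integrable φ := hf.integrable_exp_neg_mul_rieszIntegral hpos hpt hα hθ
  have hF : 𝓕 G = fun w => φ ((-(2 * Real.pi)) • w) := by
    ext w
    rw [Real.fourier_eq']
    simp only [hφ]
    rw [exp_neg_mul_rieszIntegral]
    refine integral_congr_ae (ae_of_all _ fun η => ?_)
    simp only [smul_eq_mul]
    rw [mul_comm, inner_smul_right, mul_comm Complex.I, neg_mul]
  have hpi : -(2 * Real.pi) ≠ 0 := by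
    have := Real.pi_pos
    linarith
  have hFint : Integrable (𝓕 G) := by
    rw [hF]
    exact hφint.comp_smul hpi
  have hinv := hGint.fourierInv_fourier_eq hFint (v := 0) hGcont.continuousAt
  rw [Real.fourierInv_eq'] at hinv
  simp only [inner_zero_right, mul_zero, Complex.ofReal_zero, zero_mul, Complex.exp_zero,
    one_smul] at hinv
  rw [hF, Measure.integral_comp_smul, finrank_euclideanSpace_fin] at hinv
  have hfθ := fn_pos_of_mem hpos hθ
  have hG0 : G 0 = ((fn f θ ^ (-α) : ℝ) : ℂ) := by
    simp only [hG]
    rw [logBranch_zero, Real.rpow_def_of_pos hfθ]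
    push_cast
    ring_nf
  have habs : |((-(2 * Real.pi)) ^ d)⁻¹| = ((2 * Real.pi) ^ d)⁻¹ := by
    rw [abs_inv, abs_pow, abs_neg, abs_of_pos (by positivity)]
  rw [hG0, habs, Complex.real_smul] at hinv
  have h2pi : (((2 * Real.pi) ^ d : ℝ) : ℂ) ≠ 0 := by
    have := Real.pi_pos
    exact_mod_cast (pow_pos (by positivity : (0 : ℝ) < 2 * Real.pi) d).ne'
  rw [Complex.ofReal_mul, ← hinv, Complex.ofReal_inv, ← mul_assoc, mul_inv_cancel₀ h2pi, one_mul]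

/-- Every base measure of a hyperbolic exponential family represents `f ^ (-α)`. -/
lemma IsHyperbolic.laplace_of_isHypBase (hf : IsHyperbolic f p e) (hpos : 0 < fn f e)
    (hpt : IsPointed (hypCone f e)) {μ : Measure (dualCone (hypCone f e))}
    {h : dualCone (hypCone f e) → ℝ} (hν : IsHypBase f e α μ h) :
    0 < α ∧ ∀ θ ∈ hypCone f e,
      Integrable (fun σ : dualCone (hypCone f e) => Real.exp (-⟪θ, (σ : E d)⟫) * h σ) μ ∧
      ∫ σ : dualCone (hypCone f e), Real.exp (-⟪θ, (σ : E d)⟫) * h σ ∂μ = fn f θ ^ (-α) := by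
  rcases hν with ⟨hα, rfl, θ₀, hθ₀, hh⟩ | hν
  · refine ⟨(Nat.cast_nonneg d).trans_lt hα, fun θ hθ => ?_⟩
    have hK : MeasurableSet (dualCone (hypCone f e)) := (isClosed_dualCone _).measurableSet
    set c : ℝ := ((2 * Real.pi) ^ d)⁻¹ with hc
    set ψ : E d → ℝ := fun σ =>
      c * ((Real.exp (-⟪θ, σ⟫) : ℂ) * rieszIntegral f α θ σ).re with hψ
    have hint := hf.integrable_exp_neg_mul_rieszIntegral hpos hpt hα hθ
    have hψint : Integrable ψ := hint.re.const_mul c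
    have heq : (fun σ : dualCone (hypCone f e) => Real.exp (-⟪θ, (σ : E d)⟫) * h σ) =
        fun σ : dualCone (hypCone f e) => ψ (σ : E d) := by
      ext σ
      have : h σ = c * (rieszIntegral f α θ₀ σ).re := by
        rw [hh, rieszKernel]
        rfl
      simp only [this, hψ]
      rw [Complex.re_ofReal_mul, hf.rieszIntegral_eq hpos hpt hα hθ hθ₀]
      ring
    rw [heq]
    refine ⟨(integrableOn_iff_comap_subtypeVal hK).mp hψint.integrableOn, ?_⟩
    rw [integral_subtype_comap hK ψ, setIntegral_eq_integral_of_forall_compl_eq_zero fun σ hσ => by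
      simp [hψ, hf.rieszIntegral_eq_zero hpos hpt hα hθ hσ]]
    have hre : ∫ σ : E d, ((Real.exp (-⟪θ, σ⟫) : ℂ) * rieszIntegral f α θ σ).re =
        (∫ σ : E d, (Real.exp (-⟪θ, σ⟫) : ℂ) * rieszIntegral f α θ σ).re := integral_re hint
    rw [hψ, integral_const_mul, hre, hf.integral_exp_neg_mul_rieszIntegral hpos hpt hα hθ,
      Complex.ofReal_re, hc, ← mul_assoc, inv_mul_cancel₀, one_mul]
    have := Real.pi_pos
    positivity
  · exact hν

end Inversion

/-! ### The embedding and the projection of a subspace -/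

section Subspace

variable {d c : ℕ} {ℒ : Submodule ℝ (E d)} (b : Module.Basis (Fin c) ℝ ℒ)

lemma embed_eq (τ : E c) : embed b τ = ((b.equivFun.symm (fun i => τ i) : ℒ) : E d) := by
  ext j
  simp [embed, rowMatrix, Module.Basis.equivFun_symm_apply, Matrix.toLpLin_apply, Matrix.mulVec,
    dotProduct, mul_comm]

lemma embed_mem (τ : E c) : embed b τ ∈ ℒ := by
  rw [embed_eq]
  exact Subtype.property _

lemma embed_injective : Function.Injective (embed b) := by
  intro τ τ' h
  rw [embed_eq, embed_eq] at h
  have := b.equivFun.symm.injective (Subtype.ext h)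
  ext i
  exact congrFun this i

lemma exists_embed_eq {x : E d} (hx : x ∈ ℒ) : ∃ τ, embed b τ = x := by
  refine ⟨WithLp.toLp 2 (b.equivFun ⟨x, hx⟩), ?_⟩
  rw [embed_eq]
  simp

lemma inner_embed (τ : E c) (σ : E d) : ⟪embed b τ, σ⟫ = ⟪τ, proj b σ⟫ := by
  simp only [embed, proj, rowMatrix, PiLp.inner_apply, Matrix.toLpLin_apply, Matrix.mulVec,
    dotProduct, Matrix.transpose_apply, Matrix.of_apply, RCLike.inner_apply, conj_trivial,
    Finset.mul_sum, Finset.sum_mul]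
  rw [Finset.sum_comm]
  exact Finset.sum_congr rfl fun i _ => Finset.sum_congr rfl fun j _ => by ring

/-- The orthogonal complement of the range is the kernel of the adjoint `embed b`, which is
injective. -/
lemma proj_surjective : Function.Surjective (proj b) := by
  rw [← LinearMap.range_eq_top, ← Submodule.orthogonal_eq_bot_iff, Submodule.eq_bot_iff]
  intro τ hτ
  rw [Submodule.mem_orthogonal'] at hτ
  refine embed_injective b ?_
  rw [map_zero, ← inner_self_eq_zero (𝕜 := ℝ), inner_embed]
  exact hτ _ (LinearMap.mem_range_self _ _)

end Subspace

/-! ### Parameters and gradients of hyperbolic exponential families -/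

section Family

variable {d p : ℕ} {f : MvPolynomial (Fin d) ℝ} {e : E d} {α : ℝ}
  {μ : Measure (dualCone (hypCone f e))} {h : dualCone (hypCone f e) → ℝ}

/-- `∇ log f` is homogeneous of degree `-1`. -/
lemma gradLog_smul (hom : f.IsHomogeneous p) {a : E d} (ha : fn f a ≠ 0) {s : ℝ} (hs : s ≠ 0) :
    gradLog f (s • a) = s⁻¹ • gradLog f a := by
  refine ext_inner_right ℝ fun v => ?_
  have hsa : fn f (s • a) ≠ 0 := by
    rw [fn_smul hom]
    exact mul_ne_zero (pow_ne_zero _ hs) ha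
  have h1 := hasDerivAt_log_fn_line (f := f) (s • a) v (s := 0) (by simpa using hsa)
  have h2 := hasDerivAt_log_fn_line (f := f) a (s⁻¹ • v) (s := 0) (by simpa using ha)
  have hc : Continuous fun t : ℝ => fn f (a + t • s⁻¹ • v) := (continuous_fn f).comp (by fun_prop)
  have heq : (fun t : ℝ => Real.log (fn f (s • a + t • v))) =ᶠ[𝓝 0]
      fun t : ℝ => Real.log (s ^ p) + Real.log (fn f (a + t • s⁻¹ • v)) := by
    filter_upwards [hc.continuousAt.eventually_ne (x := (0 : ℝ)) (by simpa using ha)] with t ht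
    rw [← Real.log_mul (pow_ne_zero _ hs) ht, ← fn_smul hom, smul_add, smul_comm t, smul_smul,
      mul_inv_cancel₀ hs, one_smul]
  have := h1.unique ((h2.const_add _).congr_of_eventuallyEq heq)
  simpa [real_inner_smul_left, real_inner_smul_right] using this

/-- The partition integral diverges outside the cone, since `f ^ (-α)` blows up at the boundary. -/
lemma params_familyOn (hpos : 0 < fn f e) (hα : 0 < α)
    (hlap : ∀ θ ∈ hypCone f e,
      Integrable (fun σ : dualCone (hypCone f e) => Real.exp (-⟪θ, (σ : E d)⟫) * h σ) μ ∧
      ∫ σ : dualCone (hypCone f e), Real.exp (-⟪θ, (σ : E d)⟫) * h σ ∂μ = fn f θ ^ (-α)) :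
    (familyOn (dualCone (hypCone f e)) μ h).params = hypCone f e := by
  refine Subset.antisymm (fun θ hθ => ?_) fun θ hθ => (hlap θ hθ).1
  have hθint : Integrable
      (fun σ : dualCone (hypCone f e) => Real.exp (-⟪θ, (σ : E d)⟫) * h σ) μ := hθ
  have heC : e ∈ hypCone f e := mem_hypCone_self hpos.ne'
  by_contra hθC
  set x : ℝ → E d := fun t => θ + t • (e - θ) with hx
  have hxc : Continuous x := by fun_prop
  set S : Set ℝ := Icc 0 1 ∩ x ⁻¹' (hypCone f e)ᶜ with hS
  have hScomp : IsCompact S :=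
    isCompact_Icc.inter_right ((isOpen_hypCone f e).isClosed_compl.preimage hxc)
  -- The last parameter outside the cone on the way from `θ` to `e`. There the segment is on the
  -- boundary of the cone, so `f` vanishes.
  obtain ⟨t, ⟨⟨ht0, ht1⟩, htC⟩, htmax⟩ := hScomp.exists_isGreatest
    ⟨0, ⟨left_mem_Icc.mpr zero_le_one, by simpa [hx] using hθC⟩⟩
  have htlt : t < 1 := lt_of_le_of_ne ht1 fun h1 => htC (by simpa [hx, h1] using heC)
  have hmem : ∀ s ∈ Ioc t 1, x s ∈ hypCone f e := by
    intro s hs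
    by_contra hsC
    exact absurd (htmax ⟨⟨ht0.trans hs.1.le, hs.2⟩, hsC⟩) (not_le.mpr hs.1)
  have hIoc : Ioc t 1 ∈ 𝓝[>] t := Ioc_mem_nhdsGT htlt
  have hlim : Tendsto x (𝓝[>] t) (𝓝 (x t)) := hxc.continuousAt.tendsto.mono_left nhdsWithin_le_nhds
  have hzero : fn f (x t) = 0 := by
    by_contra hne
    exact htC (mem_hypCone_of_mem_closure (mem_closure_of_tendsto hlim
      (Filter.mem_of_superset hIoc hmem)) hne)
  have heint := (hlap e heC).1
  -- By monotonicity of `exp`, the exponential at a point of the segment is at most the sum of those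
  -- at its ends. Absolute values are needed since `h` may change sign.
  set B : ℝ := ∫ σ : dualCone (hypCone f e), (‖Real.exp (-⟪θ, (σ : E d)⟫) * h σ‖ +
    ‖Real.exp (-⟪e, (σ : E d)⟫) * h σ‖) ∂μ with hB
  have hbound : ∀ s ∈ Ioc t 1, 1 ≤ B * fn f (x s) ^ α := by
    intro s hs
    have hs0 : 0 ≤ s := ht0.trans hs.1.le
    have hfx := fn_pos_of_mem hpos (hmem s hs)
    have h1 : fn f (x s) ^ (-α) ≤ B := by
      rw [← (hlap _ (hmem s hs)).2]
      have hsum : Integrable (fun σ : dualCone (hypCone f e) =>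
          ‖Real.exp (-⟪θ, (σ : E d)⟫) * h σ‖ + ‖Real.exp (-⟪e, (σ : E d)⟫) * h σ‖) μ :=
        hθint.norm.add heint.norm
      refine (Real.le_norm_self _).trans (norm_integral_le_of_norm_le hsum (ae_of_all _ fun σ => ?_))
      rw [norm_mul, norm_mul, norm_mul, ← add_mul]
      refine mul_le_mul_of_nonneg_right ?_ (norm_nonneg _)
      simp only [Real.norm_eq_abs, Real.abs_exp]
      have hin : -⟪x s, (σ : E d)⟫ = (1 - s) * -⟪θ, (σ : E d)⟫ + s * -⟪e, (σ : E d)⟫ := by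
        simp only [hx]
        rw [inner_add_left, real_inner_smul_left, inner_sub_left]
        ring
      rw [hin]
      rcases le_total (-⟪θ, (σ : E d)⟫) (-⟪e, (σ : E d)⟫) with hle | hle
      · have : (1 - s) * -⟪θ, (σ : E d)⟫ + s * -⟪e, (σ : E d)⟫ ≤ -⟪e, (σ : E d)⟫ := by
          nlinarith [hs.2]
        linarith [Real.exp_le_exp.mpr this, Real.exp_pos (-⟪θ, (σ : E d)⟫)]
      · have : (1 - s) * -⟪θ, (σ : E d)⟫ + s * -⟪e, (σ : E d)⟫ ≤ -⟪θ, (σ : E d)⟫ := by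
          nlinarith [hs.2]
        linarith [Real.exp_le_exp.mpr this, Real.exp_pos (-⟪e, (σ : E d)⟫)]
    rw [Real.rpow_neg hfx.le, inv_le_iff_one_le_mul₀ (Real.rpow_pos_of_pos hfx α)] at h1
    exact h1
  have hlim2 : Tendsto (fun s => B * fn f (x s) ^ α) (𝓝[>] t) (𝓝 0) := by
    have := (((continuous_fn f).tendsto _).comp hlim).rpow_const (p := α) (Or.inr hα.le)
    rw [hzero, Real.zero_rpow hα.ne'] at this
    simpa using this.const_mul B
  have := ge_of_tendsto hlim2 (Filter.mem_of_superset hIoc hbound)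
  linarith

lemma logPartition_familyOn (hpos : 0 < fn f e)
    (hlap : ∀ θ ∈ hypCone f e,
      ∫ σ : dualCone (hypCone f e), Real.exp (-⟪θ, (σ : E d)⟫) * h σ ∂μ = fn f θ ^ (-α))
    {θ : E d} (hθ : θ ∈ hypCone f e) :
    HasGradientAt (familyOn (dualCone (hypCone f e)) μ h).logPartition (-(α • gradLog f θ)) θ := by
  have h1 : HasGradientAt (fun x => Real.log (fn f x)) (gradLog f θ) θ :=
    (differentiableAt_log_fn (fn_ne_zero_of_mem hθ)).hasGradientAt
  have h2 := (h1.hasFDerivAt.const_mul (-α)).hasGradientAt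
  have hg : (InnerProductSpace.toDual ℝ (E d)).symm
      (-α • InnerProductSpace.toDual ℝ (E d) (gradLog f θ)) = -(α • gradLog f θ) := by
    simp
  rw [hg] at h2
  refine HasFDerivAt.congr_of_eventuallyEq h2.hasFDerivAt ?_
  filter_upwards [(isOpen_hypCone f e).mem_nhds hθ] with x hx
  have hpart : (familyOn (dualCone (hypCone f e)) μ h).partition x = fn f x ^ (-α) := hlap x hx
  rw [ExpFamily.logPartition, hpart, Real.log_rpow (fn_pos_of_mem hpos hx)]

end Family

section Restrict

variable {X : Type} [MeasurableSpace X] {n m : ℕ} (𝓕 : ExpFamily X n) {M : E m →ₗ[ℝ] E n}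
  {N : E n →ₗ[ℝ] E m}

lemma integrand_restrict (hMN : ∀ τ σ, ⟪M τ, σ⟫ = ⟪τ, N σ⟫) (τ : E m) :
    (𝓕.restrict N).integrand τ = 𝓕.integrand (M τ) := by
  ext x
  simp only [ExpFamily.integrand, ExpFamily.restrict, hMN]

lemma params_restrict (hMN : ∀ τ σ, ⟪M τ, σ⟫ = ⟪τ, N σ⟫) :
    (𝓕.restrict N).params = M ⁻¹' 𝓕.params := by
  ext τ
  simp only [ExpFamily.params, mem_preimage, mem_ofPred_eq, integrand_restrict 𝓕 hMN]
  rfl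

lemma logPartition_restrict (hMN : ∀ τ σ, ⟪M τ, σ⟫ = ⟪τ, N σ⟫) (τ : E m) :
    (𝓕.restrict N).logPartition τ = 𝓕.logPartition (M τ) := by
  simp only [ExpFamily.logPartition, ExpFamily.partition, integrand_restrict 𝓕 hMN]
  rfl

/-- Chain rule: precomposing with `M` applies its adjoint `N` to the gradient. -/
lemma hasGradientAt_logPartition_restrict (hMN : ∀ τ σ, ⟪M τ, σ⟫ = ⟪τ, N σ⟫) {τ : E m} {g : E n}
    (hg : HasGradientAt 𝓕.logPartition g (M τ)) :
    HasGradientAt (𝓕.restrict N).logPartition (N g) τ := by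
  have hM : HasFDerivAt M (LinearMap.toContinuousLinearMap M) τ :=
    (LinearMap.toContinuousLinearMap M).hasFDerivAt
  have h1 := hg.hasFDerivAt.comp τ hM
  rw [hasGradientAt_iff_hasFDerivAt, funext (logPartition_restrict 𝓕 hMN)]
  refine h1.congr_fderiv ?_
  ext v
  simp [real_inner_comm, ← hMN]

end Restrict

end HypExp
end

/-! ### The main theorem -/

open HypExp in
theorem theorem3 {d p c : ℕ} (f : MvPolynomial (Fin d) ℝ) (τ₀ : E d)
    (hf : IsHyperbolic f p τ₀) (hpos : 0 < fn f τ₀) (hpointed : IsPointed (hypCone f τ₀))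
    (α : ℝ) (μ : Measure (dualCone (hypCone f τ₀))) (h : dualCone (hypCone f τ₀) → ℝ)
    (hν : IsHypBase f τ₀ α μ h)
    (ℒ : Submodule ℝ (E d)) (b : Module.Basis (Fin c) ℝ ℒ)
    (hℒ : (hypCone f τ₀ ∩ (ℒ : Set (E d))).Nonempty) :
    let C : Set (E d) := hypCone f τ₀
    let K : Set (E d) := dualCone C
    let 𝓕 : ExpFamily K d := familyOn K μ h
    let 𝓕L : ExpFamily K c := 𝓕.restrict (proj b)
    let CL : Set (E c) := 𝓕L.params
    let KL : Set (E c) := 𝓕L.statSpace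
    let P : Set (E d) := posExpVariety f τ₀ ℒ
    -- the full family and its gradient map `𝓕.gradientMap = α ∇ log f : C → K`
    𝓕.params = C ∧ 𝓕.statSpace = K ∧
    (∀ θ ∈ C, 0 < 𝓕.partition θ ∧ DifferentiableAt ℝ 𝓕.logPartition θ ∧
      𝓕.gradientMap θ = α • gradLog f θ) ∧
    -- the restricted family and the factorization of its gradient map
    Convex ℝ CL ∧ BijOn (embed b) CL (C ∩ ℒ) ∧
    MapsTo (gradLog f) C K ∧ MapsTo 𝓕.gradientMap C K ∧ MapsTo (proj b) K KL ∧
    (∀ τ ∈ CL, DifferentiableAt ℝ 𝓕L.logPartition τ ∧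
      𝓕L.gradientMap τ = proj b (𝓕.gradientMap (embed b τ))) ∧
    -- the two bijections
    BijOn (fun τ => gradLog f (embed b τ)) CL P ∧
    BijOn (fun τ => 𝓕.gradientMap (embed b τ)) CL P ∧
    BijOn (proj b) P (interior KL) := by
  intro C K 𝓕 𝓕L CL KL P
  obtain ⟨hα, hlap⟩ := hf.laplace_of_isHypBase hpos hpointed hν
  have hpar : 𝓕.params = C := params_familyOn hpos hα hlap
  have hstat : 𝓕.statSpace = K := by
    change convexHull ℝ (range (Subtype.val : K → E d)) = K
    rw [Subtype.range_coe, (convex_dualCone C).convexHull_eq]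
  have hgrad : ∀ θ ∈ C, HasGradientAt 𝓕.logPartition (-(α • gradLog f θ)) θ := fun θ hθ =>
    logPartition_familyOn hpos (fun x hx => (hlap x hx).2) hθ
  have hgmap : ∀ θ ∈ C, 𝓕.gradientMap θ = α • gradLog f θ := fun θ hθ => by
    rw [ExpFamily.gradientMap, (hgrad θ hθ).gradient, neg_neg]
  have hMN := inner_embed b
  have hCL : CL = embed b ⁻¹' C := by
    rw [← hpar]
    exact params_restrict 𝓕 hMN
  have hmem : ∀ τ ∈ CL, embed b τ ∈ C := fun τ hτ => by rwa [hCL] at hτ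
  have hbij : BijOn (embed b) CL (C ∩ ℒ) := by
    refine ⟨fun τ hτ => ⟨hmem τ hτ, embed_mem b τ⟩, (embed_injective b).injOn, ?_⟩
    rintro x ⟨hxC, hxℒ⟩
    obtain ⟨τ, rfl⟩ := exists_embed_eq b hxℒ
    exact ⟨τ, by rwa [hCL], rfl⟩
  have hKL : KL = proj b '' K := by
    have hr : range 𝓕L.stat = proj b '' K := by
      ext y
      constructor
      · rintro ⟨σ, rfl⟩
        exact ⟨σ, σ.2, rfl⟩
      · rintro ⟨σ, hσ, rfl⟩
        exact ⟨⟨σ, hσ⟩, rfl⟩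
    change convexHull ℝ (range 𝓕L.stat) = _
    rw [hr, ((convex_dualCone C).linear_image (proj b)).convexHull_eq]
  have hFint : ∀ θ ∈ C, gradLog f θ ∈ interior K := fun θ hθ =>
    hf.gradLog_mem_interior hpointed hθ
  have hFinj : InjOn (gradLog f) C := by
    intro θ hθ θ' hθ' heq
    by_contra hne
    have := hf.inner_gradLog_sub_neg hpointed hθ hθ' hne
    rw [heq, sub_self, inner_zero_left] at this
    exact lt_irrefl _ this
  have hFbij : BijOn (fun τ => gradLog f (embed b τ)) CL P :=
    (hFinj.mono inter_subset_left).bijOn_image.comp hbij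
  -- Homogeneity of degree `-1` turns the factor `α` into a rescaling of the argument, which
  -- preserves `C` and `ℒ`.
  have hscale : ∀ θ ∈ C, 𝓕.gradientMap θ = gradLog f (α⁻¹ • θ) := fun θ hθ => by
    rw [hgmap θ hθ, gradLog_smul hf.homogeneous (fn_ne_zero_of_mem hθ) (inv_ne_zero hα.ne'), inv_inv]
  refine ⟨hpar, hstat, fun θ hθ => ⟨?_, (hgrad θ hθ).differentiableAt, hgmap θ hθ⟩, ?_, hbij,
    fun θ hθ => interior_subset (hFint θ hθ), fun θ hθ => ?_, fun σ hσ => ?_, fun τ hτ => ?_, hFbij,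
    ⟨fun τ hτ => ?_, fun τ hτ τ' hτ' heq => ?_, ?_⟩, ⟨?_, ?_, ?_⟩⟩
  · have : 𝓕.partition θ = fn f θ ^ (-α) := (hlap θ hθ).2
    rw [this]
    exact Real.rpow_pos_of_pos (fn_pos_of_mem hpos hθ) _
  · rw [hCL]
    exact hf.convex_hypCone.linear_preimage (embed b)
  · rw [hscale θ hθ]
    exact interior_subset (hFint _ (hf.smul_mem hθ (inv_pos.mpr hα)))
  · rw [hKL]
    exact mem_image_of_mem _ hσ
  · have hg := hgrad _ (hmem τ hτ)
    have hgL := hasGradientAt_logPartition_restrict 𝓕 hMN hg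
    refine ⟨hgL.differentiableAt, ?_⟩
    rw [ExpFamily.gradientMap, ExpFamily.gradientMap, hg.gradient, hgL.gradient, ← map_neg]
  · have hτC := hmem τ hτ
    simp only
    rw [hscale _ hτC]
    exact ⟨_, ⟨hf.smul_mem hτC (inv_pos.mpr hα), ℒ.smul_mem _ (embed_mem b τ)⟩, rfl⟩
  · simp only at heq
    rw [hgmap _ (hmem τ hτ), hgmap _ (hmem τ' hτ')] at heq
    exact hFbij.injOn hτ hτ' (smul_right_injective _ hα.ne' heq)
  · rintro _ ⟨θ, ⟨hθC, hθℒ⟩, rfl⟩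
    obtain ⟨τ, hτ, hτθ⟩ := hbij.surjOn ⟨hf.smul_mem hθC hα, ℒ.smul_mem α hθℒ⟩
    refine ⟨τ, hτ, ?_⟩
    simp only
    rw [hscale _ (hmem τ hτ), hτθ, smul_smul, inv_mul_cancel₀ hα.ne', one_smul]
  · rintro _ ⟨θ, ⟨hθC, -⟩, rfl⟩
    rw [hKL]
    -- A surjective linear map is open, so it carries interior points of `K` to interior points of
    -- the image.
    exact (LinearMap.isOpenMap_of_finiteDimensional _ (proj_surjective b)).image_interior_subset _
      (mem_image_of_mem _ (hFint θ hθC))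
  · rintro _ ⟨θ, ⟨hθC, hθℒ⟩, rfl⟩ _ ⟨θ', ⟨hθ'C, hθ'ℒ⟩, rfl⟩ heq
    by_contra hne
    have hneg := hf.inner_gradLog_sub_neg hpointed hθC hθ'C fun h => hne (by rw [h])
    -- As `θ' - θ` lies in `ℒ`, pairing it with the difference of gradients only sees the
    -- projections of these, which agree; strict monotonicity is contradicted.
    obtain ⟨τ, hτ⟩ := exists_embed_eq b (ℒ.sub_mem hθ'ℒ hθℒ)
    rw [real_inner_comm, ← hτ, inner_embed, map_sub, heq, sub_self, inner_zero_right] at hneg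
    exact lt_irrefl _ hneg
  · intro s hs
    rw [hKL] at hs
    obtain ⟨x, hxC, hxℒ⟩ := hℒ
    obtain ⟨τ₁, rfl⟩ := exists_embed_eq b hxℒ
    obtain ⟨τ, hτ, rfl⟩ := hf.exists_proj_gradLog_eq hpos (embed b) (proj b) hMN ⟨τ₁, hxC⟩ hs
    exact ⟨_, ⟨_, ⟨hτ, embed_mem b τ⟩, rfl⟩, rfl⟩
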